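/- Let $w(x) = (x|\log x|)^{-3/2}$, $c(x) = x|\log x|$ and $\varphi = w$ on $[0,\tfrac12]$, and let $H = L^2([0,\tfrac12])$, $V = L^2([0,\tfrac12], w(x)\,dx)$ be the complex Hilbert spaces, so that $V$ embeds continuously, injectively and densely into $H$, and $H$ embeds into the antidual $V'$. For $T>0$, $\alpha \in (0,1)$, $q \in (1,\infty)$ and a Banach space $X$, let $\dot W^{\alpha,q}([0,T];X)$ be the space of Bochner measurable $g\colon [0,T]\to X$ with $\int_0^T\int_0^T \|g(t)-g(s)\|_X^q\,|t-s|^{-1-\alpha q}\,ds\,dt < \infty$. There is $d_0>0$ such that for all $d \ge d_0$ and all $T>0$ the function $$u(t,x) = c(x)\bigl(\sin(t\varphi(x)) + d\bigr), \qquad t \in [0,T],\ x\in[0,\tfrac12],$$ has the following properties. (1) For every $t\in[0,T]$ the function $x \mapsto \partial_t u(t,x)$ is not in $H$. Moreover $u \in L^\infty([0,T];V)$, the map $u\colon[0,T]\to V'$ is continuously differentiable, and $\dot u(t) \in V'\setminus H$ for all $t\in[0,T]$. (2) $u \in \dot W^{1/2,q}([0,T];V)$ for all $q\in(2,\infty)$.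 (3) There is a non-autonomous symmetric, uniformly bounded and uniformly coercive sesquilinear form $a\colon[0,T]\times V\times V\to\mathbb C$ whose induced operators $\mathcal A(t)\colon V\to V'$ satisfy $\mathcal A \in \dot W^{1/2,q}([0,T];\mathcal B(V,V'))$ for all $q\in(2,\infty)$, such that $\dot u(t) + \mathcal A(t)u(t) = u(t)$ in $V'$ for all $t\in[0,T]$, and such that $u$ is an integrated solution of this problem with right-hand side $f = u$ and initial value $u(0)$, i.e. for all $t\in[0,T]$ one has in $V'$ $$u(t) = e^{-t\mathcal A(t)}u(0) + \int_0^t e^{-(t-s)\mathcal A(t)}\bigl(\mathcal A(t)-\mathcal A(s)\bigr)u(s)\,ds + \int_0^t e^{-(t-s)\mathcal A(t)} f(s)\,ds,$$ where $(e^{-s\mathcal A(t)})_{s\ge0}$ is the strongly continuous semigroup on $V'$ with generator $-\mathcal A(t)$ (with domain $V$). (4) For the same form $a$, with $A(t)$ the part of $\mathcal A(t)$ in $H$, the problem $\dot v(t) + A(t)v(t) = f(t)$, $v(0)=v_0$ on $H$ does not have maximal $L^p$-regularity for any $p\in[1,\infty]$. Here maximal $L^p$-regularity means that for all $f\in L^p([0,T];H)$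 and all $v_0$ in the real interpolation space $(D(A(0)),H)_{1/p,p}$ there is a unique $v \in W^{1,p}([0,T];H)$ with $v(0)=v_0$, $v(t)\in D(A(t))$ for almost every $t$, $A(\cdot)v(\cdot)\in L^p([0,T];H)$ and $\dot v + A(\cdot)v = f$ almost everywhere, together with an estimate $\|v\|_{W^{1,p}} + \|A(\cdot)v\|_{L^p} \le C(\|f\|_{L^p} + \|v_0\|_{(D(A(0)),H)_{1/p,p}})$. In fact there is one $f\in L^\infty([0,T];V)$ such that for no $p\in[1,\infty]$ such a solution $v$ exists for $f$ and $v_0=0$. -/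

import Mathlib

open MeasureTheory Set
open scoped ENNReal NNReal

noncomputable section

namespace NonAutonomousForms

/-! ### Forms on a pair of Hilbert spaces, with embedding `j : V → H` -/

section Abstract

variable {V H X : Type*}
  [NormedAddCommGroup V] [InnerProductSpace ℂ V]
  [NormedAddCommGroup H] [InnerProductSpace ℂ H]
  [NormedAddCommGroup X] [NormedSpace ℝ X]

/-- The antidual `V'` of `V`: bounded conjugate-linear functionals, with the operator norm. -/
abbrev AntiDual (V : Type*) [NormedAddCommGroup V] [InnerProductSpace ℂ V] : Type _ :=
  V →L⋆[ℂ] ℂ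

/-- Bounded sesquilinear forms on `V`, linear in the first and conjugate-linear in the second
variable, identified with the operators `v ↦ a(v, ·)` in `B(V, V')`. The norm is that of
`B(V, V')`. -/
abbrev SesqForm (V : Type*) [NormedAddCommGroup V] [InnerProductSpace ℂ V] : Type _ :=
  V →L[ℂ] AntiDual V

/-- The map `H → V'`, `h ↦ (v ↦ (h | j v)_H)`. (In Mathlib `inner` is conjugate-linear in its
first variable.) -/
def toAntiDual (j : V →L[ℂ] H) : H →L[ℂ] AntiDual V :=
  LinearMap.mkContinuous
    { toFun := fun h => ((innerSL ℂ).flip h).comp j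
      map_add' := fun x y => by ext v; simp
      map_smul' := fun c x => by ext v; simp }
    ‖j‖ (fun h => by
      refine ContinuousLinearMap.opNorm_le_bound _ (by positivity) (fun v => ?_)
      have h1 : ‖inner ℂ (j v) h‖ ≤ ‖j v‖ * ‖h‖ := norm_inner_le_norm _ _
      have h2 : ‖j v‖ * ‖h‖ ≤ (‖j‖ * ‖v‖) * ‖h‖ :=
        mul_le_mul_of_nonneg_right (j.le_opNorm v) (norm_nonneg h)
      calc ‖(((innerSL ℂ).flip h).comp j) v‖ = ‖inner ℂ (j v) h‖ := by simp
        _ ≤ (‖j‖ * ‖v‖) * ‖h‖ := h1.trans h2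
        _ = ‖j‖ * ‖h‖ * ‖v‖ := by ring)

theorem toAntiDual_apply (j : V →L[ℂ] H) (h : H) (v : V) :
    toAntiDual j h v = inner ℂ (j v) h := by
  simp [toAntiDual]

/-- A non-autonomous form on `[0,T]` that is uniformly bounded and uniformly coercive. -/
def IsBoundedCoercive (T : ℝ) (a : ℝ → SesqForm V) : Prop :=
  ∃ ε M : ℝ, 0 < ε ∧ 0 < M ∧ ∀ t ∈ Icc (0 : ℝ) T, ∀ u v : V,
    ε * ‖u‖ ^ 2 ≤ (a t u u).re ∧ ‖a t u v‖ ≤ M * ‖u‖ * ‖v‖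

/-- A non-autonomous form on `[0,T]` is symmetric if `a(t,u,v)` is the conjugate of
`a(t,v,u)`. -/
def IsSymmetricForm (T : ℝ) (a : ℝ → SesqForm V) : Prop :=
  ∀ t ∈ Icc (0 : ℝ) T, ∀ u v : V, a t u v = starRingEnd ℂ (a t v u)

/-- The (Gagliardo) seminorm of the homogeneous fractional Sobolev space
of order `α` and exponent `q` on `[0,T]`. -/
def fracSobolevSeminorm (T α q : ℝ) (f : ℝ → X) : ℝ≥0∞ :=
  (∫⁻ t in Icc (0 : ℝ) T, ∫⁻ s in Icc (0 : ℝ) T,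
    ‖f t - f s‖ₑ ^ q / ENNReal.ofReal (|t - s| ^ (1 + α * q))) ^ (1 / q)

/-- Membership in the homogeneous fractional Sobolev space of order `α` and exponent `q` on
`[0,T]`: Bochner measurability and finite seminorm. -/
def MemFracSobolev (T α q : ℝ) (f : ℝ → X) : Prop :=
  AEStronglyMeasurable f (volume.restrict (Icc (0 : ℝ) T)) ∧ fracSobolevSeminorm T α q f < ∞

/-- `(S s)` for `s ≥ 0` is a strongly continuous semigroup of bounded operators on `V'`. -/
structure IsC0Semigroup (S : ℝ → AntiDual V →L[ℂ] AntiDual V) : Prop where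
  zero : S 0 = ContinuousLinearMap.id ℂ (AntiDual V)
  add : ∀ s t : ℝ, 0 ≤ s → 0 ≤ t → S (s + t) = (S s).comp (S t)
  continuousOn : ∀ x : AntiDual V, ContinuousOn (fun s => S s x) (Ici 0)

/-- `S` is the semigroup `s ↦ e^{-s𝒜}` on `V'`: a strongly continuous semigroup whose generator
is `-𝒜`, where `𝒜` is the operator in `V'` with domain `V` induced by the form `b`. The semigroup
is determined by its generator. -/
def IsFormSemigroup (j : V →L[ℂ] H) (b : SesqForm V)
    (S : ℝ → AntiDual V →L[ℂ] AntiDual V) : Prop :=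
  IsC0Semigroup S ∧ ∀ x y : AntiDual V,
    HasDerivWithinAt (fun s => S s x) y (Ici 0) 0 ↔
      ∃ v : V, toAntiDual j (j v) = x ∧ y = -(b v)

/-- `u : [0,T] → V` is an integrated solution of `u̇ + 𝒜(t) u = f`, `u(0) = u₀`: for all
`t ∈ [0,T]` one has in `V'`
`u(t) = e^{-t𝒜(t)} u₀ + ∫₀ᵗ e^{-(t-s)𝒜(t)} (𝒜(t) - 𝒜(s)) u(s) ds + ∫₀ᵗ e^{-(t-s)𝒜(t)} f(s) ds`,
both integrals existing as Bochner integrals. -/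
def IsIntegratedSolution (j : V →L[ℂ] H) (T : ℝ) (a : ℝ → SesqForm V) (f : ℝ → H) (u₀ : H)
    (u : ℝ → V) : Prop :=
  ∃ S : ℝ → ℝ → AntiDual V →L[ℂ] AntiDual V,
    (∀ t ∈ Icc (0 : ℝ) T, IsFormSemigroup j (a t) (S t)) ∧
    ∀ t ∈ Icc (0 : ℝ) T,
      IntervalIntegrable (fun s => S t (t - s) ((a t - a s) (u s))) volume 0 t ∧
      IntervalIntegrable (fun s => S t (t - s) (toAntiDual j (f s))) volume 0 t ∧
      toAntiDual j (j (u t)) = S t t (toAntiDual j u₀)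
        + (∫ s in (0 : ℝ)..t, S t (t - s) ((a t - a s) (u s)))
        + ∫ s in (0 : ℝ)..t, S t (t - s) (toAntiDual j (f s))

/-- The graph of the part `A` in `H` of the operator `V → V'` induced by the form `b`:
`x ∈ D(A)` and `A x = y`. -/
def IsPart (j : V →L[ℂ] H) (b : SesqForm V) (x y : H) : Prop :=
  ∃ v : V, j v = x ∧ b v = toAntiDual j y

/-- The K-functional of the couple `(D(A), H)`, where `A` is the part of `b` in `H` and `D(A)`
carries the graph norm. -/
def kFunctional (j : V →L[ℂ] H) (b : SesqForm V) (s : ℝ) (x : H) : ℝ≥0∞ :=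
  ⨅ (y : H) (z : H) (_ : IsPart j b y z),
    (‖y‖ₑ + ‖z‖ₑ) + ENNReal.ofReal s * ‖x - y‖ₑ

/-- The norm of the real interpolation space `(D(A), H)_{1/p,p}` given by the K-method (the
value is `∞` outside of the space). -/
def traceNorm (j : V →L[ℂ] H) (b : SesqForm V) (p : ℝ≥0∞) (x : H) : ℝ≥0∞ :=
  eLpNorm (fun s : ℝ => ENNReal.ofReal (s ^ (-(p⁻¹).toReal)) * kFunctional j b s x) p
    ((volume.restrict (Ioi (0 : ℝ))).withDensity (fun s => ENNReal.ofReal s⁻¹))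

/-- `u` is a maximal `L^p`-regularity solution of `u̇ + A(t) u = f`, `u(0) = u₀` on `[0,T]`, with
`u' = u̇` and `g = A(·) u(·)`: one has `u, u̇, A(·)u(·) ∈ L^p([0,T];H)`, `u(t) ∈ D(A(t))` for
almost all `t`, and the equation holds almost everywhere. The representative `u` of a function in
`W^{1,p}([0,T];H)` is the continuous one, i.e. the primitive of its derivative. -/
structure IsMaxRegSolution (j : V →L[ℂ] H) (T : ℝ) (p : ℝ≥0∞) (a : ℝ → SesqForm V)
    (f : ℝ → H) (u₀ : H) (u u' g : ℝ → H) : Prop where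
  memLp : MemLp u p (volume.restrict (Icc (0 : ℝ) T))
  memLp_deriv : MemLp u' p (volume.restrict (Icc (0 : ℝ) T))
  memLp_op : MemLp g p (volume.restrict (Icc (0 : ℝ) T))
  primitive : ∀ t ∈ Icc (0 : ℝ) T, u t = u₀ + ∫ s in (0 : ℝ)..t, u' s
  op : ∀ᵐ t ∂(volume.restrict (Icc (0 : ℝ) T)), IsPart j (a t) (u t) (g t)
  eqn : ∀ᵐ t ∂(volume.restrict (Icc (0 : ℝ) T)), u' t + g t = f t

/-- Maximal `L^p`-regularity of the problem on `H` associated with the form `a`: for all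
`f ∈ L^p([0,T];H)` and all `u₀ ∈ (D(A(0)), H)_{1/p,p}` there is a unique maximal
`L^p`-regularity solution, and the maximal regularity estimate holds. -/
def HasMaximalRegularity (j : V →L[ℂ] H) (T : ℝ) (p : ℝ≥0∞) (a : ℝ → SesqForm V) : Prop :=
  (∀ (f : ℝ → H) (u₀ : H), MemLp f p (volume.restrict (Icc (0 : ℝ) T)) →
    traceNorm j (a 0) p u₀ < ∞ →
    (∃ u u' g : ℝ → H, IsMaxRegSolution j T p a f u₀ u u' g) ∧
    ∀ u u' g v v' h : ℝ → H, IsMaxRegSolution j T p a f u₀ u u' g →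
      IsMaxRegSolution j T p a f u₀ v v' h → EqOn u v (Icc 0 T)) ∧
  ∃ C : ℝ≥0, ∀ (f : ℝ → H) (u₀ : H) (u u' g : ℝ → H),
    MemLp f p (volume.restrict (Icc (0 : ℝ) T)) → traceNorm j (a 0) p u₀ < ∞ →
    IsMaxRegSolution j T p a f u₀ u u' g →
      eLpNorm u p (volume.restrict (Icc (0 : ℝ) T))
        + eLpNorm u' p (volume.restrict (Icc (0 : ℝ) T))
        + eLpNorm g p (volume.restrict (Icc (0 : ℝ) T))
      ≤ C * (eLpNorm f p (volume.restrict (Icc (0 : ℝ) T)) + traceNorm j (a 0) p u₀)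

end Abstract

/-! ### The concrete spaces and the concrete function -/

/-- The weight `w(x) = (x |log x|)^{-3/2}`. -/
def weight (x : ℝ) : ℝ := (x * |Real.log x|) ^ (-(3 / 2) : ℝ)

/-- Lebesgue measure on `[0,1/2]`. -/
def baseMeasure : Measure ℝ := volume.restrict (Icc (0 : ℝ) (1 / 2))

/-- The measure `w(x) dx` on `[0,1/2]`. -/
def weightedMeasure : Measure ℝ := baseMeasure.withDensity (fun x => ENNReal.ofReal (weight x))

/-- `H = L²([0,1/2])`, complex-valued. -/
abbrev SpaceH : Type := Lp ℂ 2 baseMeasure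

/-- `V = L²([0,1/2], w)`, complex-valued. -/
abbrev SpaceV : Type := Lp ℂ 2 weightedMeasure

theorem one_le_weight {x : ℝ} (h0 : 0 < x) (h1 : x ≤ 1 / 2) : 1 ≤ weight x := by
  have hlog : Real.log x < 0 := Real.log_neg h0 (by linarith)
  have habs : |Real.log x| = Real.log x⁻¹ := by rw [abs_of_neg hlog, Real.log_inv]
  have hle : Real.log x⁻¹ ≤ x⁻¹ - 1 := Real.log_le_sub_one_of_pos (inv_pos.2 h0)
  have hpos : 0 < x * |Real.log x| := mul_pos h0 (abs_pos.2 hlog.ne)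
  have hle1 : x * |Real.log x| ≤ 1 := by
    rw [habs]
    calc x * Real.log x⁻¹ ≤ x * (x⁻¹ - 1) := mul_le_mul_of_nonneg_left hle h0.le
      _ = 1 - x := by field_simp
      _ ≤ 1 := by linarith
  exact Real.one_le_rpow_of_pos_of_le_one_of_nonpos hpos hle1 (by norm_num)

theorem baseMeasure_le_weightedMeasure : baseMeasure ≤ weightedMeasure := by
  have hae : ∀ᵐ x ∂baseMeasure, (1 : ℝ≥0∞) ≤ ENNReal.ofReal (weight x) := by
    have h0 : ∀ᵐ x ∂baseMeasure, x ≠ (0 : ℝ) := by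
      unfold baseMeasure
      exact ae_restrict_of_ae (Measure.ae_ne volume 0)
    have h1 : ∀ᵐ x ∂baseMeasure, x ∈ Icc (0 : ℝ) (1 / 2) := by
      unfold baseMeasure
      exact ae_restrict_mem measurableSet_Icc
    filter_upwards [h0, h1] with x hx0 hx1
    have := one_le_weight (lt_of_le_of_ne hx1.1 (Ne.symm hx0)) hx1.2
    simpa using ENNReal.ofReal_le_ofReal this
  calc baseMeasure = baseMeasure.withDensity 1 := withDensity_one.symm
    _ ≤ weightedMeasure := withDensity_mono hae

/-- The embedding `V → H`, which sends (the class of) a function to (the class of) the same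
function. -/
def embed : SpaceV →L[ℂ] SpaceH :=
  LinearMap.mkContinuous
    { toFun := fun f => ((Lp.memLp f).mono_measure baseMeasure_le_weightedMeasure).toLp f
      map_add' := fun f g => by
        rw [← MemLp.toLp_add]
        exact MemLp.toLp_congr _ _
          (baseMeasure_le_weightedMeasure.absolutelyContinuous.ae_le (Lp.coeFn_add f g))
      map_smul' := fun c f => by
        rw [RingHom.id_apply, ← MemLp.toLp_const_smul]
        exact MemLp.toLp_congr _ _
          (baseMeasure_le_weightedMeasure.absolutelyContinuous.ae_le (Lp.coeFn_smul c f)) }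
    1 (fun f => by
      rw [one_mul]
      change ‖((Lp.memLp f).mono_measure baseMeasure_le_weightedMeasure).toLp f‖ ≤ ‖f‖
      rw [Lp.norm_toLp, Lp.norm_def]
      exact ENNReal.toReal_mono (Lp.eLpNorm_ne_top f)
        (eLpNorm_mono_measure _ baseMeasure_le_weightedMeasure))

theorem coeFn_embed (f : SpaceV) : embed f =ᵐ[baseMeasure] f :=
  MemLp.coeFn_toLp ((Lp.memLp f).mono_measure baseMeasure_le_weightedMeasure)

/-- The function `u(t,x) = c(x) (sin(t φ(x)) + d)` with `c(x) = x |log x|` and `φ = w`. -/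
def profile (d t x : ℝ) : ℝ := x * |Real.log x| * (Real.sin (t * weight x) + d)

end NonAutonomousForms

end

/-! The curve `u` comes first and the form is built around it. The Riesz isomorphism identifies `V'`
with `V`. Under it `H` becomes the range of `j*`, which is division by `w`, and `V → V'` becomes the
Gram operator `j* j`. The formal derivative `c w cos(tw)` of `u` then turns into `p(t) = c cos(tw)`.
This lies in `V`, so `u` is differentiable in `V'` (`norm_gramOp_curve_sub_le`). It comes from `H`
only if `c w cos(tw)` is square integrable. But `(c w)² = 1/c = 1/(x |log x|)` is not integrable at
`0`, and the factor `cos²` does not help: `2 cos² θ = 1 + cos 2θ`, and the oscillating half has a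
bounded primitive up to a bounded error (`not_integrableOn_inv_mul_cos_sq`).

The equation requires symmetric coercive operators `B(t)` on `V` with `B u = j* j u - p`. Take `B =
l + κ⁻¹ (· | k) k` with `k = j* j u - p - l u` and `κ = (k | u)`. The rank-one term maps `u` to `k`,
so the equation holds, and coercivity only needs `κ` to be bounded below by a positive constant. For
large `d` this is true, since `‖j u‖²` grows like `d²` while `(p | u)` grows like `d`
(`exists_curve_coercive`, `exists_form_of_curve`).

Time regularity of `B` is inherited from `u` and `p`. With `h = |t - s|`, their increments are at
most `c min(2, h w)` pointwise, and the squared `V`-norm of this function is `O(h / |log h|)` for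
small `h` (`lintegral_modulusDensity_le`). The Gagliardo integral then reduces to `∫ |log h|^(-q/2)
dh/h` near `0`, finite for `q > 2` (`lintegral_logModulus_lt_top`).

The integrated-solution formula is Duhamel's formula with the form frozen at time `t`
(`isIntegratedSolution_of_hasDerivAt`). The semigroup is obtained from continuous functional
calculus: after conjugation by `√B` its generator is minus the inverse of a positive injective
operator.

Maximal regularity fails because `t u(t)` solves the problem in `V'` with zero initial value and
right-hand side `u + t u`, which is bounded in `V`. An energy argument valid down to `p = 1` shows
that any maximal regularity solution has the same derivative `u + t u̇`
(`IsMaxRegSolution.ae_adjoint_deriv_eq`). This would force `u̇(t)` into `H` for some `t > 0`. -/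

noncomputable section

namespace NonAutonomousForms

open Filter Topology

/-! ### The Riesz isomorphism onto the antidual -/

section Riesz

variable {V H : Type*}
  [NormedAddCommGroup V] [InnerProductSpace ℂ V] [CompleteSpace V]
  [NormedAddCommGroup H] [InnerProductSpace ℂ H] [CompleteSpace H]

/-- The Riesz isomorphism `V → V'`, `v ↦ (w ↦ (v | w)_V)`. -/
def riesz (V : Type*) [NormedAddCommGroup V] [InnerProductSpace ℂ V] [CompleteSpace V] :
    V ≃ₗᵢ[ℂ] AntiDual V :=
  LinearIsometryEquiv.ofSurjective
    { toLinearMap := (innerSLFlip ℂ : V →L[ℂ] AntiDual V)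
      norm_map' := fun v => by
        refine le_antisymm (ContinuousLinearMap.opNorm_le_bound _ (norm_nonneg _) fun w => ?_) ?_
        · simpa [mul_comm] using norm_inner_le_norm (𝕜 := ℂ) w v
        · rcases eq_or_ne v 0 with rfl | hv
          · simp
          · have h := ContinuousLinearMap.le_opNorm (innerSLFlip ℂ v : AntiDual V) v
            have h2 : ‖(innerSLFlip ℂ v : AntiDual V) v‖ = ‖v‖ * ‖v‖ := by
              simp [inner_self_eq_norm_sq_to_K, sq]
            rw [h2] at h
            exact le_of_mul_le_mul_right h (norm_pos_iff.2 hv) }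
    (fun l => by
      -- Conjugating the values of an antilinear functional makes it linear, so the usual Riesz
      -- theorem applies.
      refine ⟨(InnerProductSpace.toDual ℂ V).symm
        (((starL ℂ : ℂ ≃L⋆[ℂ] ℂ) : ℂ →L⋆[ℂ] ℂ).comp l), ?_⟩
      ext w
      change inner ℂ w _ = l w
      rw [← inner_conj_symm, InnerProductSpace.toDual_symm_apply]
      simp)

theorem riesz_apply (v w : V) : riesz V v w = inner ℂ w v := rfl

/-- Moves every question about `H ⊂ V'` into `V`: being in `H` becomes being in the range of `j*`.
-/
theorem toAntiDual_eq_riesz (j : V →L[ℂ] H) (h : H) :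
    toAntiDual j h = riesz V (j.adjoint h) := by
  ext w
  rw [toAntiDual_apply, riesz_apply, ContinuousLinearMap.adjoint_inner_right]

/-- The operator `j* j` on `V`, which represents the embedding `V → V'`. -/
def gramOp (j : V →L[ℂ] H) : V →L[ℂ] V := j.adjoint ∘L j

theorem gramOp_nonneg (j : V →L[ℂ] H) : 0 ≤ gramOp j :=
  (ContinuousLinearMap.nonneg_iff_isPositive _).2
    (ContinuousLinearMap.isPositive_adjoint_comp_self j)

theorem inner_gramOp (j : V →L[ℂ] H) (v w : V) :
    inner ℂ v (gramOp j w) = inner ℂ (j v) (j w) := by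
  simp [gramOp, ContinuousLinearMap.adjoint_inner_right]

theorem gramOp_injective {j : V →L[ℂ] H} (hj : Function.Injective j) :
    Function.Injective (gramOp j) := by
  rw [injective_iff_map_eq_zero]
  intro v hv
  have := inner_gramOp j v v
  rw [hv, inner_zero_right, eq_comm, inner_self_eq_zero] at this
  exact hj (by simpa using this)

end Riesz

/-! ### Strong limits of functions of a positive operator -/

section StrongLimit

variable {V : Type*} [NormedAddCommGroup V] [InnerProductSpace ℂ V]

/-- An `ε/2` argument: uniform boundedness extends strong convergence from the dense range of `Q` to
the whole space. Applied to functions of `Q` that converge uniformly only after multiplication by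
`Q`. -/
theorem tendsto_apply_of_denseRange {ι : Type*} {l : Filter ι} {F : ι → V →L[ℂ] V}
    {G Q : V →L[ℂ] V} {C : ℝ} (hC : ∀ᶠ i in l, ‖F i‖ ≤ C) (hQ : DenseRange Q)
    (h : ∀ y, Tendsto (fun i => F i (Q y)) l (𝓝 (G (Q y)))) (x : V) :
    Tendsto (fun i => F i x) l (𝓝 (G x)) := by
  rw [Metric.tendsto_nhds]
  intro ε hε
  have hK : 0 < |C| + ‖G‖ + 1 := by positivity
  obtain ⟨y, hy⟩ := hQ.exists_dist_lt x (show 0 < ε / 2 / (|C| + ‖G‖ + 1) by positivity)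
  filter_upwards [hC, (Metric.tendsto_nhds.1 (h y)) (ε / 2) (by positivity)] with i hi1 hi2
  have e : F i x - G x = F i (x - Q y) - G (x - Q y) + (F i (Q y) - G (Q y)) := by
    simp only [map_sub]; abel
  rw [dist_eq_norm] at hy hi2 ⊢
  rw [e]
  have h1 : ‖F i (x - Q y)‖ ≤ |C| * ‖x - Q y‖ :=
    ((F i).le_opNorm _).trans (by gcongr; exact hi1.trans (le_abs_self C))
  have h2 := G.le_opNorm (x - Q y)
  have h3 : (|C| + ‖G‖ + 1) * ‖x - Q y‖ < ε / 2 := by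
    rw [lt_div_iff₀ hK] at hy; linarith
  have h4 := norm_add_le (F i (x - Q y) - G (x - Q y)) (F i (Q y) - G (Q y))
  have h5 := norm_sub_le (F i (x - Q y)) (G (x - Q y))
  nlinarith [norm_nonneg (x - Q y)]

variable [CompleteSpace V]

/-- The orthogonal complement of the range of a self-adjoint operator is its kernel. -/
theorem denseRange_of_nonneg_of_injective {Q : V →L[ℂ] V} (h0 : 0 ≤ Q)
    (hi : Function.Injective Q) : DenseRange Q := by
  have hsa : Q.adjoint = Q := (IsSelfAdjoint.of_nonneg h0).star_eq
  have h := Q.orthogonal_range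
  rw [hsa] at h
  have hk : (Q : V →ₗ[ℂ] V).ker = ⊥ := LinearMap.ker_eq_bot.2 hi
  have h3 : ((Q : V →ₗ[ℂ] V).range).topologicalClosure = ⊤ := by
    rw [Submodule.topologicalClosure_eq_top_iff, h]; exact hk
  rw [DenseRange, dense_iff_closure_eq]
  exact congrArg (fun S : Submodule ℂ V => (S : Set V)) h3

/-- Since `0` may belong to the spectrum, `f i → c` need not be uniform there. Uniformity of `x f i
x → c x` suffices, because the extra factor `Q` has dense range. -/
theorem cfc_apply_tendsto {ι : Type*} {l : Filter ι} {Q : V →L[ℂ] V} (h0 : 0 ≤ Q)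
    (hi : Function.Injective Q) {f : ι → ℝ → ℝ} {c C : ℝ} {δ : ι → ℝ}
    (hf : ∀ᶠ i in l, ContinuousOn (f i) (Ici 0))
    (hC : ∀ᶠ i in l, ∀ x, 0 ≤ x → |f i x| ≤ C)
    (hδ : ∀ᶠ i in l, ∀ x, 0 ≤ x → |f i x * x - c * x| ≤ δ i) (hδ0 : Tendsto δ l (𝓝 0)) (x : V) :
    Tendsto (fun i => cfc (f i) Q x) l (𝓝 ((c : ℂ) • x)) := by
  have hsp : spectrum ℝ Q ⊆ Ici 0 := fun y hy => spectrum_nonneg_of_nonneg h0 hy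
  have hsa : IsSelfAdjoint Q := IsSelfAdjoint.of_nonneg h0
  have key := tendsto_apply_of_denseRange (F := fun i => cfc (f i) Q)
    (G := (c : ℂ) • ContinuousLinearMap.id ℂ V) (C := |C|) (l := l) ?_
    (denseRange_of_nonneg_of_injective h0 hi) ?_ x
  · simpa using key
  · filter_upwards [hC] with i hi
    exact norm_cfc_le (abs_nonneg _) fun y hy => (hi y (hsp hy)).trans (le_abs_self C)
  · intro y
    rw [tendsto_iff_norm_sub_tendsto_zero]
    have hlim : Tendsto (fun i => |δ i| * ‖y‖) l (𝓝 0) := by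
      simpa using (hδ0.abs).mul_const ‖y‖
    refine squeeze_zero' (Eventually.of_forall fun i => norm_nonneg _) ?_ hlim
    filter_upwards [hf, hδ] with i hfi hdi
    have e1 : cfc (fun x => f i x * x - c * x) Q = cfc (f i) Q * Q - (c : ℂ) • Q := by
      rw [cfc_sub (fun x => f i x * x) (fun x => c * x) Q
        ((hfi.mono hsp).mul continuousOn_id) (by fun_prop),
        cfc_mul (f i) (fun x => x) Q (hfi.mono hsp) (by fun_prop),
        cfc_const_mul c (fun x => x) Q (by fun_prop), cfc_id' ℝ Q]
      rfl
    have e2 : cfc (f i) Q (Q y) - ((c : ℂ) • ContinuousLinearMap.id ℂ V) (Q y)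
        = cfc (fun x => f i x * x - c * x) Q y := by
      rw [e1]; simp
    rw [e2]
    refine (ContinuousLinearMap.le_opNorm _ _).trans ?_
    gcongr
    exact norm_cfc_le (abs_nonneg _) fun y hy => (hdi y (hsp hy)).trans (le_abs_self _)

end StrongLimit

/-! ### The semigroup generated by minus the inverse of a positive operator -/

/-- The function `e^{-s/x}` for `x > 0`, continuously extended by `0` if `s > 0`. -/
def heatFun (s x : ℝ) : ℝ := if s ≤ 0 then 1 else expNegInvGlue (x / s)

theorem heatFun_zero (x : ℝ) : heatFun 0 x = 1 := by simp [heatFun]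

theorem heatFun_of_pos {s x : ℝ} (hs : 0 ≤ s) (hx : 0 < x) :
    heatFun s x = Real.exp (-(s / x)) := by
  rcases hs.eq_or_lt with rfl | hs
  · simp [heatFun]
  · have : 0 < x / s := by positivity
    simp [heatFun, expNegInvGlue, not_le.2 hs, not_le.2 this]

theorem continuous_heatFun (s : ℝ) : Continuous (heatFun s) := by
  unfold heatFun
  split_ifs
  · exact continuous_const
  · have : Continuous expNegInvGlue := (expNegInvGlue.contDiff (n := 0)).continuous
    fun_prop

theorem heatFun_add {s t : ℝ} (hs : 0 ≤ s) (ht : 0 ≤ t) {x : ℝ} (hx : 0 ≤ x) :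
    heatFun (s + t) x = heatFun s x * heatFun t x := by
  rcases hx.eq_or_lt with rfl | hx
  · rcases hs.eq_or_lt with rfl | hs
    · simp [heatFun]
    · have : 0 < s + t := by positivity
      simp [heatFun, expNegInvGlue, not_le.2 this, not_le.2 hs]
  · rw [heatFun_of_pos (by positivity) hx, heatFun_of_pos hs hx, heatFun_of_pos ht hx,
      ← Real.exp_add]
    congr 1; ring

theorem abs_heatFun_le (s x : ℝ) : |heatFun s x| ≤ 1 := by
  unfold heatFun
  split_ifs
  · simp
  · rw [abs_of_nonneg (expNegInvGlue.nonneg _)]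
    unfold expNegInvGlue
    split_ifs with h
    · simp
    · rw [Real.exp_le_one_iff, Left.neg_nonpos_iff, inv_nonneg]
      exact (not_le.1 h).le

theorem abs_exp_neg_sub_exp_neg_le {a b : ℝ} (ha : 0 ≤ a) (hb : 0 ≤ b) :
    |Real.exp (-a) - Real.exp (-b)| ≤ |a - b| := by
  wlog h : a ≤ b generalizing a b
  · rw [abs_sub_comm, abs_sub_comm a]
    exact this hb ha (le_of_not_ge h)
  rw [abs_of_nonneg (sub_nonneg.2 (Real.exp_le_exp.2 (by linarith))), abs_of_nonpos (by linarith)]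
  have h1 : Real.exp (-b) = Real.exp (-a) * Real.exp (-(b - a)) := by
    rw [← Real.exp_add]; congr 1; ring
  have h2 := Real.add_one_le_exp (-(b - a))
  have h3 : Real.exp (-a) ≤ 1 := Real.exp_le_one_iff.2 (by linarith)
  rw [h1]
  nlinarith [Real.exp_pos (-a)]

theorem abs_exp_neg_sub_one_add_le {a : ℝ} (ha : 0 ≤ a) :
    |Real.exp (-a) - 1 + a| ≤ a ^ 2 := by
  have h1 := Real.add_one_le_exp (-a)
  have h2 : Real.exp (-a) * (1 + a) ≤ 1 := by
    have := Real.add_one_le_exp a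
    calc Real.exp (-a) * (1 + a) ≤ Real.exp (-a) * Real.exp a := by gcongr; linarith
      _ = 1 := by rw [← Real.exp_add]; simp
  rw [abs_of_nonneg (by linarith)]
  nlinarith [Real.exp_pos (-a)]

/-- The factor `x` absorbs the Lipschitz constant `1/x` of `s ↦ e^{-s/x}`, so the bound is uniform
up to `x = 0`. -/
theorem abs_heatFun_mul_sub_le {s t x : ℝ} (hs : 0 ≤ s) (ht : 0 ≤ t) (hx : 0 ≤ x) :
    |heatFun s x * x - heatFun t x * x| ≤ |s - t| := by
  rcases hx.eq_or_lt with rfl | hx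
  · simp
  · rw [heatFun_of_pos hs hx, heatFun_of_pos ht hx, ← sub_mul, abs_mul, abs_of_pos hx]
    have := abs_exp_neg_sub_exp_neg_le (a := s / x) (b := t / x) (by positivity) (by positivity)
    rw [← sub_div, abs_div, abs_of_pos hx, le_div_iff₀ hx] at this
    exact this

/-- Second-order Taylor bound for the exponential. One factor `x` places the vector in the domain of
the generator, the other is the one needed for `cfc_apply_tendsto`. -/
theorem abs_heatFun_slope_le {s x : ℝ} (hs : 0 < s) (hx : 0 ≤ x) :
    |s⁻¹ * (heatFun s x - 1) * x * x - (-1) * x| ≤ s := by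
  rcases hx.eq_or_lt with rfl | hx
  · simpa using hs.le
  · rw [heatFun_of_pos hs.le hx]
    have := abs_exp_neg_sub_one_add_le (a := s / x) (by positivity)
    have e : s⁻¹ * (Real.exp (-(s / x)) - 1) * x * x - (-1) * x
      = (s⁻¹ * x * x) * (Real.exp (-(s / x)) - 1 + s / x) := by
        field_simp; ring
    rw [e, abs_mul, abs_of_pos (by positivity : 0 < s⁻¹ * x * x)]
    calc s⁻¹ * x * x * |Real.exp (-(s / x)) - 1 + s / x| ≤ s⁻¹ * x * x * (s / x) ^ 2 := by gcongr
      _ = s := by field_simp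

section Semigroup

variable {V : Type*} [NormedAddCommGroup V] [InnerProductSpace ℂ V] [CompleteSpace V]

/-- The operator `e^{-s Q⁻¹}`. -/
def heatOp (Q : V →L[ℂ] V) (s : ℝ) : V →L[ℂ] V := cfc (heatFun s) Q

variable {Q : V →L[ℂ] V}

theorem heatOp_zero (h0 : 0 ≤ Q) : heatOp Q 0 = 1 := by
  have hsa : IsSelfAdjoint Q := IsSelfAdjoint.of_nonneg h0
  have : heatFun 0 = fun _ => 1 := funext heatFun_zero
  rw [heatOp, this, cfc_const_one ℝ Q]

theorem heatOp_add (h0 : 0 ≤ Q) {s t : ℝ} (hs : 0 ≤ s) (ht : 0 ≤ t) :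
    heatOp Q (s + t) = heatOp Q s * heatOp Q t := by
  rw [heatOp, heatOp, heatOp, ← cfc_mul _ _ Q (continuous_heatFun s).continuousOn
    (continuous_heatFun t).continuousOn]
  exact cfc_congr fun x hx => heatFun_add hs ht (spectrum_nonneg_of_nonneg h0 hx)

theorem norm_heatOp_le (Q : V →L[ℂ] V) (s : ℝ) : ‖heatOp Q s‖ ≤ 1 :=
  norm_cfc_le zero_le_one fun x _ => abs_heatFun_le s x

theorem heatOp_comm (h0 : 0 ≤ Q) (s : ℝ) : heatOp Q s * Q = Q * heatOp Q s := by
  have hsa : IsSelfAdjoint Q := IsSelfAdjoint.of_nonneg h0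
  simpa [heatOp, cfc_id' ℝ Q] using (cfc_commute_cfc (heatFun s) (fun x => x) Q).eq

theorem heatOp_mul (h0 : 0 ≤ Q) (s : ℝ) :
    heatOp Q s * Q = cfc (fun x => heatFun s x * x) Q := by
  have hsa : IsSelfAdjoint Q := IsSelfAdjoint.of_nonneg h0
  rw [cfc_mul (heatFun s) (fun x => x) Q (continuous_heatFun s).continuousOn (by fun_prop),
    cfc_id' ℝ Q, heatOp]

theorem heatOp_tendsto (h0 : 0 ≤ Q) (hi : Function.Injective Q) {s : ℝ} (hs : 0 ≤ s) (x : V) :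
    Tendsto (fun t => heatOp Q t x) (𝓝[Ici 0] s) (𝓝 (heatOp Q s x)) := by
  have hsa : IsSelfAdjoint Q := IsSelfAdjoint.of_nonneg h0
  refine tendsto_apply_of_denseRange (C := 1) (Eventually.of_forall fun t => norm_heatOp_le Q t)
    (denseRange_of_nonneg_of_injective h0 hi) (fun y => ?_) x
  rw [tendsto_iff_norm_sub_tendsto_zero]
  have hlim : Tendsto (fun t => |t - s| * ‖y‖) (𝓝[Ici 0] s) (𝓝 0) := by
    have : Continuous fun t => |t - s| * ‖y‖ := by fun_prop
    simpa using (this.tendsto s).mono_left nhdsWithin_le_nhds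
  refine squeeze_zero' (Eventually.of_forall fun i => norm_nonneg _) ?_ hlim
  filter_upwards [self_mem_nhdsWithin] with t ht
  have e : heatOp Q t (Q y) - heatOp Q s (Q y)
      = cfc (fun x => heatFun t x * x - heatFun s x * x) Q y := by
    have c1 := continuous_heatFun t
    have c2 := continuous_heatFun s
    rw [cfc_sub _ _ Q (by fun_prop) (by fun_prop), ← heatOp_mul h0, ← heatOp_mul h0]
    rfl
  rw [e]
  refine (ContinuousLinearMap.le_opNorm _ _).trans ?_
  gcongr
  exact norm_cfc_le (abs_nonneg _) fun x hx =>
    abs_heatFun_mul_sub_le ht hs (spectrum_nonneg_of_nonneg h0 hx)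

/-- The difference quotients of `e^{-s Q⁻¹} Q` at `0` converge strongly to `-1`. -/
theorem heatOp_slope_tendsto (h0 : 0 ≤ Q) (hi : Function.Injective Q) (x : V) :
    Tendsto (fun s : ℝ => s⁻¹ • (heatOp Q s (Q x) - Q x)) (𝓝[>] 0) (𝓝 (-x)) := by
  have hsa : IsSelfAdjoint Q := IsSelfAdjoint.of_nonneg h0
  have key := cfc_apply_tendsto h0 hi (l := 𝓝[>] (0 : ℝ))
    (f := fun s x => s⁻¹ * (heatFun s x - 1) * x) (c := -1) (C := 1) (δ := fun s => s)
    (Eventually.of_forall fun s => by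
      have := continuous_heatFun s
      fun_prop) ?_ ?_ (tendsto_id.mono_left nhdsWithin_le_nhds) x
  · have e : ∀ s : ℝ, cfc (fun x => s⁻¹ * (heatFun s x - 1) * x) Q x
        = s⁻¹ • (heatOp Q s (Q x) - Q x) := by
      intro s
      have hc := continuous_heatFun s
      have e1 : (fun x => s⁻¹ * (heatFun s x - 1) * x)
          = fun x => s⁻¹ * (heatFun s x * x - x) := by funext x; ring
      rw [e1, cfc_const_mul _ _ Q (by fun_prop), cfc_sub _ _ Q (by fun_prop) (by fun_prop),
        ← heatOp_mul h0, cfc_id' ℝ Q]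
      rfl
    simp only [e] at key
    simpa using key
  · filter_upwards [self_mem_nhdsWithin] with s hs y hy
    have hs : 0 < s := hs
    have := abs_heatFun_mul_sub_le hs.le le_rfl hy
    rw [heatFun_zero, sub_zero, abs_of_pos hs] at this
    have e : s⁻¹ * (heatFun s y - 1) * y = s⁻¹ * (heatFun s y * y - 1 * y) := by ring
    rw [e, abs_mul, abs_of_pos (inv_pos.2 hs), inv_mul_le_iff₀ hs]
    linarith
  · filter_upwards [self_mem_nhdsWithin] with s hs y hy
    exact abs_heatFun_slope_le hs hy

/-- Identifies the generator as exactly `-Q⁻¹`, domain included. -/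
theorem hasDerivWithinAt_heatOp_iff (h0 : 0 ≤ Q) (hi : Function.Injective Q) (x y : V) :
    HasDerivWithinAt (fun s => heatOp Q s x) y (Ici 0) 0 ↔ x = Q (-y) := by
  have hset : Ici (0 : ℝ) \ {0} = Ioi 0 := by ext; simp [lt_iff_le_and_ne, eq_comm]
  have hsl : ∀ x : V, slope (fun s => heatOp Q s x) 0 = fun s : ℝ => s⁻¹ • (heatOp Q s x - x) := by
    intro x; funext s
    simp [slope_def_module, heatOp_zero h0]
  rw [hasDerivWithinAt_iff_tendsto_slope, hset, hsl]
  constructor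
  · intro h
    -- Applying `Q` to the difference quotients gives limit `Q y`; since `Q` commutes with the
    -- semigroup, that limit is also `-x`.
    have h1 := (Q.continuous.tendsto y).comp h
    have h2 : Tendsto (Q ∘ fun s : ℝ => s⁻¹ • (heatOp Q s x - x)) (𝓝[>] 0) (𝓝 (-x)) := by
      refine (heatOp_slope_tendsto h0 hi x).congr fun s => ?_
      have := congrArg (fun A : V →L[ℂ] V => A x) (heatOp_comm h0 s)
      simp only [mul_apply_eq_comp] at this
      rw [this, ← map_sub]
      exact (Q.restrictScalars ℝ).map_smul s⁻¹ _ |>.symm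
    have h3 := tendsto_nhds_unique h1 h2
    rw [map_neg, h3, neg_neg]
  · rintro rfl
    simpa using heatOp_slope_tendsto h0 hi (-y)

end Semigroup

/-! ### The semigroup on the antidual induced by a strictly positive form -/

section FormSemigroup

variable {V H : Type*}
  [NormedAddCommGroup V] [InnerProductSpace ℂ V] [CompleteSpace V]
  [NormedAddCommGroup H] [InnerProductSpace ℂ H] [CompleteSpace H]

/-- A strictly positive bounded form induces a bounded strongly continuous semigroup. -/
theorem exists_formSemigroup {j : V →L[ℂ] H} (hj : Function.Injective j) {B : V →L[ℂ] V}
    (hB : IsStrictlyPositive B) :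
    ∃ (S : ℝ → AntiDual V →L[ℂ] AntiDual V) (C : ℝ),
      IsFormSemigroup j ((riesz V : V →L[ℂ] AntiDual V) ∘L B) S ∧ ∀ s, ‖S s‖ ≤ C := by
  obtain ⟨hu, hLL⟩ := CStarAlgebra.isStrictlyPositive_iff_isUnit_sqrt_and_eq_sqrt_mul_sqrt.1 hB
  obtain ⟨L, hL⟩ := hu
  have hLsa : IsSelfAdjoint (L : V →L[ℂ] V) := by
    rw [hL]; exact IsSelfAdjoint.of_nonneg (CFC.sqrt_nonneg B)
  have hLisa : IsSelfAdjoint (↑L⁻¹ : V →L[ℂ] V) := by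
    have h1 : IsSelfAdjoint L := Units.ext hLsa.star_eq
    exact congrArg Units.val h1.inv.star_eq
  have hli : ∀ v, (↑L⁻¹ : V →L[ℂ] V) ((L : V →L[ℂ] V) v) = v := fun v =>
    congrArg (fun A : V →L[ℂ] V => A v) L.inv_mul
  have hil : ∀ v, (L : V →L[ℂ] V) ((↑L⁻¹ : V →L[ℂ] V) v) = v := fun v =>
    congrArg (fun A : V →L[ℂ] V => A v) L.mul_inv
  -- In `V` the generator is `K v ↦ -B v` with `K = j* j` and `B = L²`. Conjugation by `L` turns it
  -- into `Q (L v) ↦ -L v`, that is, `-Q⁻¹` with `Q` positive and injective.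
  set Q : V →L[ℂ] V := ↑L⁻¹ * gramOp j * ↑L⁻¹ with hQ
  have hQ0 : 0 ≤ Q :=
    hLisa.conjugate_nonneg (gramOp_nonneg j)
  have hQi : Function.Injective Q := by
    intro x y h
    have h1 := congrArg (L : V →L[ℂ] V) h
    simp only [hQ, mul_apply_eq_comp, hil] at h1
    have h2 := congrArg (L : V →L[ℂ] V) (gramOp_injective hj h1)
    simpa only [hil] using h2
  set P : V →L[ℂ] AntiDual V := (riesz V : V →L[ℂ] AntiDual V) ∘L (L : V →L[ℂ] V) with hP
  set P' : AntiDual V →L[ℂ] V :=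
    (↑L⁻¹ : V →L[ℂ] V) ∘L ((riesz V).symm : AntiDual V →L[ℂ] V) with hP'
  have hPP' : ∀ x, P (P' x) = x := fun x => by simp [hP, hP', hil]
  have hP'P : ∀ x, P' (P x) = x := fun x => by simp [hP, hP', hli]
  refine ⟨fun s => P ∘L heatOp Q s ∘L P', ‖P‖ * ‖P'‖, ⟨⟨?_, ?_, ?_⟩, ?_⟩, ?_⟩
  · ext1 x
    simp [heatOp_zero hQ0, hPP']
  · intro s t hs ht
    ext1 x
    simp [heatOp_add hQ0 hs ht, hP'P]
  · intro x s hs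
    exact (P.continuous.tendsto _).comp (heatOp_tendsto hQ0 hQi hs (P' x))
  · intro x y
    have h1 : HasDerivWithinAt (fun s => (P ∘L heatOp Q s ∘L P') x) y (Ici 0) 0 ↔
        HasDerivWithinAt (fun s => heatOp Q s (P' x)) (P' y) (Ici 0) 0 := by
      constructor
      · intro h
        have := (P'.restrictScalars ℝ).hasFDerivAt.comp_hasDerivWithinAt (0 : ℝ) h
        refine this.congr_of_mem (fun s _ => ?_) (by simp)
        simp [hP'P]
      · intro h
        have := (P.restrictScalars ℝ).hasFDerivAt.comp_hasDerivWithinAt (0 : ℝ) h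
        simpa [hPP', Function.comp_def] using this
    rw [h1, hasDerivWithinAt_heatOp_iff hQ0 hQi]
    have hK : ∀ v, toAntiDual j (j v) = P (Q ((L : V →L[ℂ] V) v)) := fun v => by
      simp [hP, hQ, hil, hli, toAntiDual_eq_riesz, gramOp]
    have hB' : ∀ v, B v = (L : V →L[ℂ] V) ((L : V →L[ℂ] V) v) := fun v => by
      rw [hL]; exact congrArg (fun A : V →L[ℂ] V => A v) hLL
    constructor
    · intro h
      refine ⟨(↑L⁻¹ : V →L[ℂ] V) (-(P' y)), ?_, ?_⟩
      · rw [hK, hil, ← h, hPP']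
      · have : (riesz V) ((L : V →L[ℂ] V) (P' y)) = y := hPP' y
        simp [hB', hil, this]
    · rintro ⟨v, rfl, rfl⟩
      rw [hK, hP'P]
      have : P' (-(((riesz V : V →L[ℂ] AntiDual V) ∘L B) v)) = -((L : V →L[ℂ] V) v) := by
        have : ((riesz V : V →L[ℂ] AntiDual V) ∘L B) v = P ((L : V →L[ℂ] V) v) := by
          simp [hP, hB']
        rw [map_neg, this, hP'P]
      rw [this, neg_neg]
  · intro s
    refine (ContinuousLinearMap.opNorm_comp_le _ _).trans ?_
    gcongr
    refine (ContinuousLinearMap.opNorm_comp_le _ _).trans ?_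
    calc ‖heatOp Q s‖ * ‖P'‖ ≤ 1 * ‖P'‖ := by gcongr; exact norm_heatOp_le Q s
      _ = ‖P'‖ := one_mul _

end FormSemigroup

/-! ### Duhamel's formula -/

section Duhamel

variable {V H : Type*}
  [NormedAddCommGroup V] [InnerProductSpace ℂ V]
  [NormedAddCommGroup H] [InnerProductSpace ℂ H]

/-- Strong continuity together with a uniform bound gives joint continuity. -/
theorem IsC0Semigroup.tendsto_apply {S : ℝ → AntiDual V →L[ℂ] AntiDual V} (hS : IsC0Semigroup S)
    {C : ℝ} (hC : ∀ s, ‖S s‖ ≤ C) {ι : Type*} {l : Filter ι} {r : ι → ℝ} {g : ι → AntiDual V}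
    {r₀ : ℝ} {g₀ : AntiDual V} (h₀ : 0 ≤ r₀) (hr : Tendsto r l (𝓝[Ici 0] r₀))
    (hg : Tendsto g l (𝓝 g₀)) : Tendsto (fun i => S (r i) (g i)) l (𝓝 (S r₀ g₀)) := by
  have h1 : Tendsto (fun i => S (r i) g₀) l (𝓝 (S r₀ g₀)) := (hS.continuousOn g₀ r₀ h₀).tendsto.comp hr
  have h2 : Tendsto (fun i => S (r i) (g i - g₀)) l (𝓝 0) := by
    have : Tendsto (fun i => C * ‖g i - g₀‖) l (𝓝 0) := by
      simpa using (tendsto_iff_norm_sub_tendsto_zero.1 hg).const_mul C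
    refine squeeze_zero_norm (fun i => ((S (r i)).le_opNorm _).trans ?_) this
    gcongr
    exact hC _
  simpa using h2.add h1

/-- Product rule: the increment splits into the semigroup acting on the slope of `w` and `S r`
acting on the slope of the orbit of `w (t - r)`. The orbit is only assumed differentiable from the
right at `0`, hence a right derivative. -/
theorem IsC0Semigroup.hasDerivWithinAt_apply_sub {S : ℝ → AntiDual V →L[ℂ] AntiDual V}
    (hS : IsC0Semigroup S) {C : ℝ} (hC : ∀ s, ‖S s‖ ≤ C) {w : ℝ → AntiDual V} {t r : ℝ}
    {y z : AntiDual V} (hr : 0 ≤ r) (hw : HasDerivAt w y (t - r))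
    (hz : HasDerivWithinAt (fun s => S s (w (t - r))) z (Ici 0) 0) :
    HasDerivWithinAt (fun r => S r (w (t - r))) (S r (z - y)) (Ioi r) r := by
  rw [hasDerivWithinAt_iff_tendsto_slope' (by simp)]
  have hset : Ici (0 : ℝ) \ {0} = Ioi 0 := by ext; simp [lt_iff_le_and_ne, eq_comm]
  rw [hasDerivWithinAt_iff_tendsto_slope, hset] at hz
  have hw' : HasDerivAt (fun r => w (t - r)) (-y) r := by
    have := HasDerivAt.scomp r hw ((hasDerivAt_id r).const_sub t)
    rw [neg_one_smul] at this
    exact this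
  have h1 : Tendsto (slope (fun r => w (t - r)) r) (𝓝[>] r) (𝓝 (-y)) :=
    (hasDerivWithinAt_iff_tendsto_slope' (by simp)).1 hw'.hasDerivWithinAt
  have hr' : Tendsto (fun r' : ℝ => r') (𝓝[>] r) (𝓝[Ici 0] r) :=
    tendsto_nhdsWithin_iff.2 ⟨tendsto_id.mono_left nhdsWithin_le_nhds, by
      filter_upwards [self_mem_nhdsWithin] with r' hr'; exact hr.trans (le_of_lt hr')⟩
  have h2 := hS.tendsto_apply hC hr hr' h1
  have h3 : Tendsto (fun r' => r' - r) (𝓝[>] r) (𝓝[>] 0) :=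
    tendsto_nhdsWithin_iff.2 ⟨by
      have : Continuous fun r' => r' - r := by fun_prop
      simpa using (this.tendsto r).mono_left nhdsWithin_le_nhds, by
      filter_upwards [self_mem_nhdsWithin] with r' hr'; exact sub_pos.2 (mem_Ioi.1 hr')⟩
  have h4 := ((S r).continuous.tendsto _).comp (hz.comp h3)
  have h5 := h2.add h4
  rw [show S r (z - y) = S r (-y) + S r z by rw [← map_add]; congr 1; abel]
  refine h5.congr' ?_
  filter_upwards [self_mem_nhdsWithin] with r' hr'
  have hr' : r < r' := hr'
  have e : S r' (w (t - r)) = S r (S (r' - r) (w (t - r))) := by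
    rw [← ContinuousLinearMap.comp_apply, ← hS.add _ _ hr (by linarith)]
    congr 2; ring
  simp only [slope_def_module, Function.comp_apply, hS.zero, sub_zero]
  rw [ContinuousLinearMap.map_smul_of_tower, ContinuousLinearMap.map_smul_of_tower, map_sub,
    map_sub, e]
  refine (smul_add (r' - r)⁻¹ _ _).symm.trans ?_
  simp

variable [CompleteSpace V] [CompleteSpace H]

/-- A strong solution of the form problem in `V'` is an integrated solution. -/
theorem isIntegratedSolution_of_hasDerivAt {j : V →L[ℂ] H} (hj : Function.Injective j) (T : ℝ)
    {B : ℝ → V →L[ℂ] V} (hB : ∀ t, IsStrictlyPositive (B t)) (hBc : Continuous B)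
    {u : ℝ → V} (hu : Continuous u) {p : ℝ → V}
    (hp : ∀ t, HasDerivAt (fun τ => gramOp j (u τ)) (p t) t) {f : ℝ → H} (hf : Continuous f)
    (heq : ∀ t, p t + B t (u t) = j.adjoint (f t)) :
    IsIntegratedSolution j T (fun t => (riesz V : V →L[ℂ] AntiDual V) ∘L B t) f (j (u 0)) u := by
  choose S C hS hC using fun t => exists_formSemigroup hj (hB t)
  refine ⟨S, fun t _ => hS t, fun t ht => ?_⟩
  have hcont : ∀ g : ℝ → AntiDual V, Continuous g →
      ContinuousOn (fun s => S t (t - s) (g s)) (Icc 0 t) := by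
    intro g hg s hs
    refine (hS t).1.tendsto_apply (hC t) (sub_nonneg.2 hs.2) ?_ (hg.continuousAt.continuousWithinAt)
    refine tendsto_nhdsWithin_iff.2 ⟨?_, ?_⟩
    · have : Continuous fun s => t - s := by fun_prop
      exact this.continuousAt.continuousWithinAt
    · filter_upwards [self_mem_nhdsWithin] with s hs
      exact sub_nonneg.2 hs.2
  set a : ℝ → SesqForm V := fun t => (riesz V : V →L[ℂ] AntiDual V) ∘L B t with ha
  have hac : Continuous a := by fun_prop
  have c1 : Continuous fun s => (a t - a s) (u s) := by fun_prop
  have c2 : Continuous fun s => toAntiDual j (f s) := by fun_prop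
  have i1 : IntervalIntegrable (fun s => S t (t - s) ((a t - a s) (u s))) volume 0 t :=
    (hcont _ c1).intervalIntegrable_of_Icc ht.1
  have i2 : IntervalIntegrable (fun s => S t (t - s) (toAntiDual j (f s))) volume 0 t :=
    (hcont _ c2).intervalIntegrable_of_Icc ht.1
  refine ⟨i1, i2, ?_⟩
  -- Freezing the form at time `t`: by the equation, `y s` is the derivative of `w` at `s` plus `a t
  -- (u s)`.
  set y : ℝ → AntiDual V := fun s => (a t - a s) (u s) + toAntiDual j (f s) with hy
  have hyc : Continuous y := c1.add c2
  set w : ℝ → AntiDual V := fun s => toAntiDual j (j (u s)) with hw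
  have hw' : ∀ s, HasDerivAt w (riesz V (p s)) s := by
    intro s
    have := ((riesz V : V →L[ℂ] AntiDual V).restrictScalars ℝ).hasFDerivAt.comp_hasDerivAt s (hp s)
    refine this.congr_of_eventuallyEq (Eventually.of_forall fun τ => ?_)
    simp [hw, toAntiDual_eq_riesz, gramOp]
  have hwc : Continuous w := continuous_iff_continuousAt.2 fun s => (hw' s).continuousAt
  have hyw : ∀ s, y s = riesz V (p s) + a t (u s) := by
    intro s
    have := congrArg (riesz V) (heq s)
    simp only [hy, toAntiDual_eq_riesz, ← this, ha]
    simp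
    abel
  have hGc : ContinuousOn (fun r => S t r (w (t - r))) (Icc 0 t) := by
    intro r hr
    refine (hS t).1.tendsto_apply (hC t) hr.1 ?_ (Continuous.continuousWithinAt (by fun_prop))
    exact tendsto_nhdsWithin_iff.2 ⟨tendsto_id.mono_left nhdsWithin_le_nhds, by
      filter_upwards [self_mem_nhdsWithin] with r hr; exact hr.1⟩
  have hyc2 : ContinuousOn (fun r => -S t r (y (t - r))) (Icc 0 t) := by
    intro r hr
    refine ((hS t).1.tendsto_apply (hC t) hr.1 ?_ (Continuous.continuousWithinAt (by fun_prop))).neg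
    exact tendsto_nhdsWithin_iff.2 ⟨tendsto_id.mono_left nhdsWithin_le_nhds, by
      filter_upwards [self_mem_nhdsWithin] with r hr; exact hr.1⟩
  -- Duhamel: `r ↦ S t r (w (t - r))` runs from `w t` to `S t t (w 0)` and has right derivative `-S
  -- t r (y (t - r))`.
  have ftc := intervalIntegral.integral_eq_sub_of_hasDeriv_right_of_le ht.1 hGc
    (f' := fun r => -S t r (y (t - r))) (fun r hr => by
      have h1 := ((hS t).2 (w (t - r)) (-(a t (u (t - r))))).2 ⟨u (t - r), rfl, rfl⟩
      have h2 := (hS t).1.hasDerivWithinAt_apply_sub (hC t) hr.1.le (hw' (t - r)) h1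
      have e : -(a t (u (t - r))) - riesz V (p (t - r)) = -y (t - r) := by rw [hyw]; abel
      rw [e, map_neg] at h2
      exact h2) (hyc2.intervalIntegrable_of_Icc ht.1)
  have hsub := intervalIntegral.integral_comp_sub_left (a := 0) (b := t)
    (fun s => S t (t - s) (y s)) t
  simp only [sub_sub_cancel, sub_self, sub_zero] at hsub
  rw [intervalIntegral.integral_neg, hsub] at ftc
  simp only [sub_self, sub_zero, (hS t).1.zero, ContinuousLinearMap.id_apply] at ftc
  have hadd : ∫ s in (0 : ℝ)..t, S t (t - s) (y s)
      = (∫ s in (0 : ℝ)..t, S t (t - s) ((a t - a s) (u s)))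
        + ∫ s in (0 : ℝ)..t, S t (t - s) (toAntiDual j (f s)) := by
    rw [← intervalIntegral.integral_add i1 i2]
    simp only [hy, map_add]
  change w t = S t t (w 0) + _ + _
  rw [add_assoc, ← hadd, ← sub_eq_iff_eq_add', ← neg_sub, ← ftc, neg_neg]

end Duhamel

/-! ### The energy identity -/

section Energy

/-- The two triangles of the square contribute equally, by Fubini and symmetry. -/
theorem integral_integral_eq_two_mul_of_symm {T : ℝ} (hT : 0 ≤ T) {κ : ℝ → ℝ → ℝ}
    (hs : ∀ s r, κ s r = κ r s)
    (hi : Integrable (Function.uncurry κ)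
      ((volume.restrict (Ioc 0 T)).prod (volume.restrict (Ioc 0 T)))) :
    ∫ s in (0 : ℝ)..T, ∫ r in (0 : ℝ)..T, κ s r
      = 2 * ∫ s in (0 : ℝ)..T, ∫ r in (0 : ℝ)..s, κ s r := by
  set μ := volume.restrict (Ioc (0 : ℝ) T) with hμ
  set κ₁ : ℝ → ℝ → ℝ := fun s r => if r ≤ s then κ s r else 0 with hκ₁
  set κ₂ : ℝ → ℝ → ℝ := fun s r => if s < r then κ s r else 0 with hκ₂
  have m1 : MeasurableSet {x : ℝ × ℝ | x.2 ≤ x.1} := measurableSet_le measurable_snd measurable_fst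
  have m2 : MeasurableSet {x : ℝ × ℝ | x.1 < x.2} := measurableSet_lt measurable_fst measurable_snd
  have i1 : Integrable (Function.uncurry κ₁) (μ.prod μ) := by
    refine (hi.indicator m1).congr (Eventually.of_forall fun x => ?_)
    simp [hκ₁, indicator, Function.uncurry]
  have i2 : Integrable (Function.uncurry κ₂) (μ.prod μ) := by
    refine (hi.indicator m2).congr (Eventually.of_forall fun x => ?_)
    simp [hκ₂, indicator, Function.uncurry]
  have e1 : ∀ s ∈ Ioc 0 T, ∫ r, κ₁ s r ∂μ = ∫ r in (0 : ℝ)..s, κ s r := by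
    intro s hs
    have h1 : (fun r => κ₁ s r) = (Iic s).indicator (κ s) := by
      funext r; simp [hκ₁, indicator]
    have h2 : Iic s ∩ Ioc 0 T = Ioc 0 s := by
      ext r; simp only [mem_inter_iff, mem_Iic, mem_Ioc]
      exact ⟨fun h => ⟨h.2.1, h.1⟩, fun h => ⟨h.2, h.1, h.2.trans hs.2⟩⟩
    rw [h1, integral_indicator measurableSet_Iic, hμ, Measure.restrict_restrict measurableSet_Iic,
      h2, intervalIntegral.integral_of_le hs.1.le]
  have e2 : ∀ r ∈ Ioc 0 T, ∫ s, κ₂ s r ∂μ = ∫ s in (0 : ℝ)..r, κ r s := by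
    intro r hr
    have h1 : (fun s => κ₂ s r) = (Iio r).indicator (κ r) := by
      funext s; simp [hκ₂, indicator, hs s r]
    have h2 : Iio r ∩ Ioc 0 T = Ioo 0 r := by
      ext s; simp only [mem_inter_iff, mem_Iio, mem_Ioc, mem_Ioo]
      exact ⟨fun h => ⟨h.2.1, h.1⟩, fun h => ⟨h.2, h.1, h.2.le.trans hr.2⟩⟩
    rw [h1, integral_indicator measurableSet_Iio, hμ, Measure.restrict_restrict measurableSet_Iio,
      h2, intervalIntegral.integral_of_le hr.1.le, integral_Ioc_eq_integral_Ioo]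
  have hsum : ∫ s, ∫ r, κ s r ∂μ ∂μ = (∫ s, ∫ r, κ₁ s r ∂μ ∂μ) + ∫ s, ∫ r, κ₂ s r ∂μ ∂μ := by
    rw [integral_integral i1, integral_integral i2, integral_integral hi]
    refine Eq.trans ?_ (integral_add i1 i2)
    refine integral_congr_ae (Eventually.of_forall fun x => ?_)
    simp only [hκ₁, hκ₂]
    by_cases h : x.2 ≤ x.1
    · simp [h, not_lt.2 h]
    · simp [h, not_le.1 h]
  rw [integral_integral_swap i2, setIntegral_congr_fun measurableSet_Ioc e1,
    setIntegral_congr_fun measurableSet_Ioc e2] at hsum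
  simp only [intervalIntegral.integral_of_le hT]
  rw [hsum]
  ring

variable {V : Type*} [NormedAddCommGroup V] [InnerProductSpace ℂ V] [CompleteSpace V]

/-- The integrated form of `(F | R F)' = 2 Re (F' | R F)` for `F` a primitive of `ζ`. Obtained from
Fubini, it needs only Bochner integrability of `ζ`. -/
theorem re_inner_integral_eq_two_mul {T : ℝ} (hT : 0 ≤ T) {ζ : ℝ → V}
    (hζ : IntervalIntegrable ζ volume 0 T) {R : V →L[ℂ] V} (hR : IsSelfAdjoint R) :
    (inner ℂ (∫ s in (0 : ℝ)..T, ζ s) (R (∫ s in (0 : ℝ)..T, ζ s))).re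
      = 2 * ∫ s in (0 : ℝ)..T, (inner ℂ (ζ s) (R (∫ r in (0 : ℝ)..s, ζ r))).re := by
  set L : V → V →L[ℝ] ℝ := fun c =>
    Complex.reCLM ∘L ((innerSL ℂ c).restrictScalars ℝ) ∘L (R.restrictScalars ℝ) with hL
  have hLa : ∀ c v, L c v = (inner ℂ c (R v)).re := fun c v => rfl
  set L' : V → V →L[ℝ] ℝ := fun c =>
    Complex.reCLM ∘L ((innerSL ℂ (R c)).restrictScalars ℝ) with hL'
  have hsymm : ∀ x y : V, (inner ℂ x (R y)).re = (inner ℂ y (R x)).re := by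
    intro x y
    rw [← ContinuousLinearMap.adjoint_inner_left, hR.adjoint_eq, ← inner_conj_symm, Complex.conj_re]
  have hsub : ∀ s ∈ Icc 0 T, IntervalIntegrable ζ volume 0 s := fun s hs =>
    hζ.mono_set (by rw [uIcc_of_le hT, uIcc_of_le hs.1]; exact Icc_subset_Icc_right hs.2)
  have h1 : ∀ s ∈ Icc 0 T, ∀ c : V, (inner ℂ c (R (∫ r in (0 : ℝ)..s, ζ r))).re
      = ∫ r in (0 : ℝ)..s, (inner ℂ c (R (ζ r))).re := fun s hs c =>
    ((L c).intervalIntegral_comp_comm (hsub s hs)).symm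
  have hTm : T ∈ Icc 0 T := ⟨hT, le_rfl⟩
  have e1 : ∫ s in (0 : ℝ)..T, (inner ℂ (ζ s) (R (∫ r in (0 : ℝ)..s, ζ r))).re
      = ∫ s in (0 : ℝ)..T, ∫ r in (0 : ℝ)..s, (inner ℂ (ζ s) (R (ζ r))).re := by
    refine intervalIntegral.integral_congr fun s hs => ?_
    rw [uIcc_of_le hT] at hs
    exact h1 s hs _
  rw [e1, ← integral_integral_eq_two_mul_of_symm hT (κ := fun s r => (inner ℂ (ζ s) (R (ζ r))).re)
    (fun s r => hsymm _ _)]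
  · have h2 : ∀ s, ∫ r in (0 : ℝ)..T, (inner ℂ (ζ s) (R (ζ r))).re
        = (inner ℂ (∫ r in (0 : ℝ)..T, ζ r) (R (ζ s))).re := fun s => by
      rw [← h1 T hTm, hsymm]
    simp only [h2]
    exact h1 T hTm _
  · have hz := hζ.1
    refine Integrable.op_fst_snd (op := fun x y : V => (inner ℂ x (R y)).re) ?_ ⟨‖R‖, ?_⟩ hz hz
    · fun_prop
    · intro x y
      refine (RCLike.abs_re_le_norm (K := ℂ) _).trans ((norm_inner_le_norm x (R y)).trans ?_)
      calc ‖x‖ * ‖R y‖ ≤ ‖x‖ * (‖R‖ * ‖y‖) := by gcongr; exact R.le_opNorm y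
        _ = _ := by ring

end Energy

/-! ### Uniqueness of solutions with integrable derivative -/

section Uniqueness

variable {V : Type*} [NormedAddCommGroup V] [InnerProductSpace ℂ V] [CompleteSpace V]

/-- A primitive of `ζ` that equals `K z` with `Re (ζ | z) ≤ 0` vanishes. -/
theorem ae_eq_zero_of_re_inner_nonpos {K : V →L[ℂ] V} (hK : 0 ≤ K) (hKi : Function.Injective K)
    {T : ℝ} {ζ z : ℝ → V} (hζ : IntegrableOn ζ (Icc 0 T))
    (hz : ∀ᵐ t ∂(volume.restrict (Icc 0 T)), ∫ s in (0 : ℝ)..t, ζ s = K (z t))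
    {b : ℝ → ℝ} (hb : IntegrableOn b (Icc 0 T))
    (hbz : ∀ᵐ t ∂(volume.restrict (Icc 0 T)), ‖ζ t‖ * ‖z t‖ ≤ b t)
    (hneg : ∀ᵐ t ∂(volume.restrict (Icc 0 T)), (inner ℂ (ζ t) (z t)).re ≤ 0) :
    ∀ᵐ t ∂(volume.restrict (Icc 0 T)), z t = 0 := by
  have hsa : IsSelfAdjoint K := IsSelfAdjoint.of_nonneg hK
  have hsp : spectrum ℝ K ⊆ Ici 0 := fun y hy => spectrum_nonneg_of_nonneg hK hy
  set ε : ℕ → ℝ := fun n => 1 / ((n : ℝ) + 1) with hε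
  have hεp : ∀ n, 0 < ε n := fun n => Nat.one_div_pos_of_nat
  have hε0 : Tendsto ε atTop (𝓝 0) := tendsto_one_div_add_atTop_nhds_zero_nat
  have hcr : ∀ n, ContinuousOn (fun x : ℝ => (x + ε n)⁻¹) (Ici 0) := fun n =>
    ContinuousOn.inv₀ (by fun_prop) fun x hx => by
      have : 0 ≤ x := hx
      have := hεp n
      positivity
  -- Resolvents replace the unbounded inverse of `K`: the operators `R n K` are contractions
  -- converging strongly to the identity, so `(ζ | R n K z)` tends to `(ζ | z)` with majorant `‖ζ‖
  -- ‖z‖`.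
  set R : ℕ → V →L[ℂ] V := fun n => cfc (fun x : ℝ => (x + ε n)⁻¹) K with hR
  have hRK : ∀ n v, R n (K v) = cfc (fun x : ℝ => (x + ε n)⁻¹ * x) K v := by
    intro n v
    rw [cfc_mul (fun x : ℝ => (x + ε n)⁻¹) (fun x => x) K ((hcr n).mono hsp) (by fun_prop),
      cfc_id' ℝ K]
    rfl
  have hle : ∀ n, ∀ x : ℝ, 0 ≤ x → |(x + ε n)⁻¹ * x| ≤ 1 := by
    intro n x hx
    have := hεp n
    rw [abs_of_nonneg (by positivity), inv_mul_le_iff₀ (by positivity)]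
    linarith
  have hRK1 : ∀ n v, ‖R n (K v)‖ ≤ ‖v‖ := by
    intro n v
    rw [hRK]
    refine (ContinuousLinearMap.le_opNorm _ _).trans ?_
    calc _ ≤ 1 * ‖v‖ := by
          gcongr
          exact norm_cfc_le zero_le_one fun x hx => hle n x (hsp hx)
      _ = ‖v‖ := one_mul _
  have hRKlim : ∀ v, Tendsto (fun n => R n (K v)) atTop (𝓝 v) := by
    intro v
    have := cfc_apply_tendsto hK hKi (l := atTop) (f := fun n x => (x + ε n)⁻¹ * x) (c := 1)
      (C := 1) (δ := ε) (Eventually.of_forall fun n => (hcr n).mul continuousOn_id)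
      (Eventually.of_forall hle) (Eventually.of_forall fun n x hx => ?_) hε0 v
    · simpa [hRK] using this
    · have := hεp n
      have e : (x + ε n)⁻¹ * x * x - 1 * x = -((x + ε n)⁻¹ * x * ε n) := by
        field_simp; ring
      rw [e, abs_neg, abs_mul, abs_of_pos this]
      calc _ ≤ 1 * ε n := by gcongr; exact hle n x hx
        _ = ε n := one_mul _
  have hzall : ∀ᵐ t, t ∈ Icc 0 T → ∫ s in (0 : ℝ)..t, ζ s = K (z t) :=
    (ae_restrict_iff' measurableSet_Icc).1 hz
  filter_upwards [hz, ae_restrict_mem measurableSet_Icc] with t htz ht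
  have hsub : Ioc 0 t ⊆ Icc 0 T := fun s hs => ⟨hs.1.le, hs.2.trans ht.2⟩
  have hζt : IntervalIntegrable ζ volume 0 t :=
    (intervalIntegrable_iff_integrableOn_Ioc_of_le ht.1).2 (hζ.mono_set hsub)
  have henergy : ∀ n, (inner ℂ (K (z t)) (R n (K (z t)))).re
      = 2 * ∫ s in (0 : ℝ)..t, (inner ℂ (ζ s) (R n (∫ r in (0 : ℝ)..s, ζ r))).re := by
    intro n
    rw [← htz]
    exact re_inner_integral_eq_two_mul ht.1 hζt (cfc_predicate _ _)
  have hl : Tendsto (fun n => (inner ℂ (K (z t)) (R n (K (z t)))).re) atTop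
      (𝓝 (inner ℂ (K (z t)) (z t)).re) :=
    (Complex.continuous_re.tendsto _).comp (tendsto_const_nhds.inner (hRKlim _))
  have haet : ∀ {P : ℝ → Prop}, (∀ᵐ s ∂(volume.restrict (Icc 0 T)), P s) →
      ∀ᵐ s ∂(volume.restrict (Ioc 0 t)), P s := fun h =>
    ae_mono (Measure.restrict_mono hsub le_rfl) h
  have hr : Tendsto
      (fun n => ∫ s in (0 : ℝ)..t, (inner ℂ (ζ s) (R n (∫ r in (0 : ℝ)..s, ζ r))).re) atTop
      (𝓝 (∫ s in (0 : ℝ)..t, (inner ℂ (ζ s) (z s)).re)) := by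
    simp only [intervalIntegral.integral_of_le ht.1]
    refine tendsto_integral_of_dominated_convergence b (fun n => ?_) (hb.mono_set hsub)
      (fun n => ?_) ?_
    · have hF : ContinuousOn (fun s => ∫ r in (0 : ℝ)..s, ζ r) (uIcc 0 t) :=
        intervalIntegral.continuousOn_primitive_interval' hζt left_mem_uIcc
      have hF' : AEStronglyMeasurable (fun s => ∫ r in (0 : ℝ)..s, ζ r)
          (volume.restrict (Ioc 0 t)) :=
        (hF.mono (by rw [uIcc_of_le ht.1]; exact Ioc_subset_Icc_self)).aestronglyMeasurable
          measurableSet_Ioc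
      exact Complex.continuous_re.comp_aestronglyMeasurable
        (hζt.1.aestronglyMeasurable.inner
          ((R n).continuous.comp_aestronglyMeasurable hF'))
    · filter_upwards [haet hz, haet hbz] with s hs hbs
      rw [hs]
      refine (RCLike.abs_re_le_norm (K := ℂ) _).trans ((norm_inner_le_norm _ _).trans ?_)
      refine le_trans ?_ hbs
      gcongr
      exact hRK1 n _
    · filter_upwards [haet hz] with s hs
      rw [hs]
      exact (Complex.continuous_re.tendsto _).comp (tendsto_const_nhds.inner (hRKlim _))
  have heq := tendsto_nhds_unique hl ((hr.const_mul 2).congr fun n => (henergy n).symm)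
  have hint : ∫ s in (0 : ℝ)..t, (inner ℂ (ζ s) (z s)).re ≤ 0 := by
    rw [intervalIntegral.integral_of_le ht.1]
    exact integral_nonpos_of_ae (haet hneg)
  have hfin : (inner ℂ (K (z t)) (z t)).re ≤ 0 := by rw [heq]; linarith
  have hsq : K = CFC.sqrt K * CFC.sqrt K := (CFC.sqrt_mul_sqrt_self K).symm
  have hssa : IsSelfAdjoint (CFC.sqrt K) := IsSelfAdjoint.of_nonneg (CFC.sqrt_nonneg K)
  have h1 : inner ℂ (K (z t)) (z t) = inner ℂ (CFC.sqrt K (z t)) (CFC.sqrt K (z t)) := by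
    conv_lhs => rw [hsq]
    rw [mul_apply_eq_comp, ← ContinuousLinearMap.adjoint_inner_right, hssa.adjoint_eq]
  rw [h1] at hfin
  have h2 : CFC.sqrt K (z t) = 0 := by
    have : ‖CFC.sqrt K (z t)‖ ^ 2 ≤ 0 := by
      rw [← inner_self_eq_norm_sq (𝕜 := ℂ)]; exact hfin
    have h3 := norm_nonneg (CFC.sqrt K (z t))
    exact norm_eq_zero.1 (by nlinarith)
  apply hKi
  rw [hsq, mul_apply_eq_comp, h2, map_zero, map_zero]

variable {H : Type*} [NormedAddCommGroup H] [InnerProductSpace ℂ H] [CompleteSpace H]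

/-- If the form problem has a solution `w` in `V'` with zero initial value, then any maximal
`L^p`-regularity solution has the same derivative. -/
theorem IsMaxRegSolution.ae_adjoint_deriv_eq {j : V →L[ℂ] H} (hj : Function.Injective j) {T : ℝ}
    {B : ℝ → V →L[ℂ] V} {ε M : ℝ} (hε : 0 < ε)
    (hB : ∀ t v, ε * ‖v‖ ^ 2 ≤ (inner ℂ v (B t v)).re) (hM : ∀ t, ‖B t‖ ≤ M)
    {w p : ℝ → V} {C : ℝ} (hwC : ∀ t ∈ Icc 0 T, ‖w t‖ ≤ C) (hw0 : w 0 = 0) (hpc : Continuous p)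
    (hp : ∀ t, HasDerivAt (fun τ => gramOp j (w τ)) (p t) t) {f : ℝ → H}
    (heq : ∀ t, p t + B t (w t) = j.adjoint (f t)) {q : ℝ≥0∞} (hq : 1 ≤ q) {v v' g : ℝ → H}
    (hv : IsMaxRegSolution j T q (fun t => (riesz V : V →L[ℂ] AntiDual V) ∘L B t) f 0 v v' g) :
    ∀ᵐ t ∂(volume.restrict (Icc 0 T)), j.adjoint (v' t) = p t := by
  have iv' : IntegrableOn v' (Icc 0 T) := hv.memLp_deriv.integrable hq
  have ig : IntegrableOn g (Icc 0 T) := hv.memLp_op.integrable hq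
  set ζ : ℝ → V := fun t => j.adjoint (v' t) - p t with hζ
  have iDv' : IntegrableOn (fun t => j.adjoint (v' t)) (Icc 0 T) :=
    j.adjoint.integrable_comp iv'
  have ip : IntegrableOn p (Icc 0 T) := hpc.continuousOn.integrableOn_Icc
  have iζ : IntegrableOn ζ (Icc 0 T) := iDv'.sub ip
  have hlift : ∀ᵐ t ∂(volume.restrict (Icc 0 T)),
      ∃ ν : V, j ν = v t ∧ B t ν = j.adjoint (g t) := by
    filter_upwards [hv.op] with t ht
    obtain ⟨ν, h1, h2⟩ := ht
    refine ⟨ν, h1, (riesz V).injective ?_⟩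
    rw [← toAntiDual_eq_riesz, ← h2]
    rfl
  -- A measurable selection is not needed: all that enters is a choice of lifts for almost every
  -- `t`, once the trivial filter is set aside.
  rcases (ae (volume.restrict (Icc 0 T))).eq_or_neBot with hbot | _
  · rw [hbot]
    exact eventually_bot
  obtain ⟨ν, hν⟩ := hlift.choice
  have hprim : ∀ t ∈ Icc 0 T, ∫ s in (0 : ℝ)..t, ζ s = j.adjoint (v t) - gramOp j (w t) := by
    intro t ht
    have hsub : Ioc 0 t ⊆ Icc 0 T := fun s hs => ⟨hs.1.le, hs.2.trans ht.2⟩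
    have i1 : IntervalIntegrable v' volume 0 t :=
      (intervalIntegrable_iff_integrableOn_Ioc_of_le ht.1).2 (iv'.mono_set hsub)
    have i2 : IntervalIntegrable (fun t => j.adjoint (v' t)) volume 0 t :=
      (intervalIntegrable_iff_integrableOn_Ioc_of_le ht.1).2 (iDv'.mono_set hsub)
    rw [hζ, intervalIntegral.integral_sub i2 (hpc.intervalIntegrable _ _),
      intervalIntegral.integral_eq_sub_of_hasDerivAt (fun s _ => hp s)
        (hpc.intervalIntegrable _ _), hw0, map_zero, sub_zero, hv.primitive t ht, zero_add,
      j.adjoint.intervalIntegral_comp_comm i1]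
  set z : ℝ → V := fun t => ν t - w t with hz
  have hFz : ∀ᵐ t ∂(volume.restrict (Icc 0 T)), ∫ s in (0 : ℝ)..t, ζ s = gramOp j (z t) := by
    filter_upwards [hν, ae_restrict_mem measurableSet_Icc] with t hνt ht
    rw [hprim t ht, hz, map_sub, ← hνt.1]
    rfl
  have hζz : ∀ᵐ t ∂(volume.restrict (Icc 0 T)), ζ t = -(B t (z t)) := by
    filter_upwards [hν, hv.eqn] with t hνt hf
    have h1 := heq t
    rw [← hf, map_add, ← hνt.2] at h1
    simp only [hζ, hz, map_sub]
    rw [neg_sub, sub_eq_sub_iff_add_eq_add, ← h1]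
    abel
  have hM0 : 0 ≤ M := (norm_nonneg _).trans (hM 0)
  set Cv : ℝ := ∫ s in Icc 0 T, ‖v' s‖ with hCv
  have hvb : ∀ t ∈ Icc 0 T, ‖v t‖ ≤ Cv := by
    intro t ht
    rw [hv.primitive t ht, zero_add]
    refine (intervalIntegral.norm_integral_le_integral_norm ht.1).trans ?_
    rw [intervalIntegral.integral_of_le ht.1]
    exact setIntegral_mono_set iv'.norm (Eventually.of_forall fun _ => norm_nonneg _)
      (LE.le.eventuallyLE fun s hs => ⟨hs.1.le, hs.2.trans ht.2⟩)
  -- Coercivity gives `ε ‖ν‖² ≤ Re (v | g) ≤ Cv ‖g‖`, because `v` is bounded as a primitive. Thus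
  -- `‖z‖²` is dominated by an integrable function even when `g` is merely integrable, which covers
  -- `q = 1`.
  set b : ℝ → ℝ := fun t => M * (2 * (Cv * ‖g t‖ / ε) + 2 * C ^ 2) with hb
  have ib : IntegrableOn b (Icc 0 T) :=
    Integrable.const_mul (((ig.norm.const_mul Cv).div_const ε).const_mul 2 |>.add
      (integrableOn_const (by simp))) M
  have hzero := ae_eq_zero_of_re_inner_nonpos (gramOp_nonneg j) (gramOp_injective hj) iζ hFz ib
    (z := z) ?_ ?_
  · filter_upwards [hzero, hζz] with t h1 h2
    rw [h1, map_zero, neg_zero] at h2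
    exact sub_eq_zero.1 h2
  · filter_upwards [hν, hζz, ae_restrict_mem measurableSet_Icc] with t hνt hζt ht
    have h1 : ε * ‖ν t‖ ^ 2 ≤ Cv * ‖g t‖ := by
      refine (hB t (ν t)).trans ?_
      rw [hνt.2, ContinuousLinearMap.adjoint_inner_right, hνt.1]
      refine (RCLike.re_le_norm (K := ℂ) _).trans ((norm_inner_le_norm _ _).trans ?_)
      gcongr
      exact hvb t ht
    have h2 : ‖ν t‖ ^ 2 ≤ Cv * ‖g t‖ / ε := by rw [le_div_iff₀ hε]; linarith
    have h3 : ‖z t‖ ≤ ‖ν t‖ + C := (norm_sub_le _ _).trans (by gcongr; exact hwC t ht)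
    have h4 : ‖z t‖ ^ 2 ≤ 2 * (Cv * ‖g t‖ / ε) + 2 * C ^ 2 := by
      nlinarith [sq_nonneg (‖ν t‖ - C), norm_nonneg (z t), norm_nonneg (ν t)]
    rw [hζt, norm_neg]
    calc ‖B t (z t)‖ * ‖z t‖ ≤ (M * ‖z t‖) * ‖z t‖ := by
          gcongr
          exact ((B t).le_opNorm _).trans (by gcongr; exact hM t)
      _ = M * ‖z t‖ ^ 2 := by ring
      _ ≤ _ := mul_le_mul_of_nonneg_left h4 hM0
  · filter_upwards [hζz] with t hζt
    have := hB t (z t)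
    have h0 : 0 ≤ ε * ‖z t‖ ^ 2 := by positivity
    rw [hζt, inner_neg_left, Complex.neg_re, ← inner_conj_symm, Complex.conj_re]
    linarith

end Uniqueness

/-! ### Functions with a logarithmic modulus of continuity -/

section Modulus

/-- The modulus of continuity `(h / |log h|)^{1/2}`, for small `h`. -/
def logModulus (h : ℝ) : ℝ := if h < 1 / 4 then √(h / |Real.log h|) else 1

theorem logModulus_nonneg (h : ℝ) : 0 ≤ logModulus h := by
  unfold logModulus; split_ifs <;> positivity

/-- The threshold `1/4` lies below `1/e`. -/
theorem one_le_abs_log {h : ℝ} (h0 : 0 < h) (h1 : h < 1 / 4) : 1 ≤ |Real.log h| := by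
  have h2 : Real.log h < -1 := by
    rw [Real.log_lt_iff_lt_exp h0, Real.exp_neg]
    refine h1.trans ?_
    rw [one_div]
    exact inv_strictAnti₀ (Real.exp_pos 1) (by linarith [Real.exp_one_lt_d9])
  rw [abs_of_neg (by linarith)]; linarith

theorem logModulus_le_one {h : ℝ} (h0 : 0 ≤ h) : logModulus h ≤ 1 := by
  unfold logModulus
  split_ifs with h1
  · rcases h0.eq_or_lt with rfl | h0
    · simp
    · rw [Real.sqrt_le_one]
      have := one_le_abs_log h0 h1
      rw [div_le_one (by linarith)]
      linarith
  · exact le_rfl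

theorem tendsto_logModulus : Tendsto logModulus (𝓝[≥] 0) (𝓝 0) := by
  have h1 : Tendsto Real.sqrt (𝓝[≥] 0) (𝓝 0) := by
    simpa using (Real.continuous_sqrt.tendsto 0).mono_left nhdsWithin_le_nhds
  refine squeeze_zero' (Eventually.of_forall logModulus_nonneg) ?_ h1
  filter_upwards [self_mem_nhdsWithin,
    mem_nhdsWithin_of_mem_nhds (Iio_mem_nhds (show (0 : ℝ) < 1 / 4 by norm_num))] with h h0 h4
  have h0 : 0 ≤ h := h0
  have h4 : h < 1 / 4 := h4
  rw [logModulus, if_pos h4]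
  refine Real.sqrt_le_sqrt ?_
  rcases h0.eq_or_lt with rfl | h0
  · simp
  · exact div_le_self h0.le (one_le_abs_log h0 h4)

variable {X : Type*} [NormedAddCommGroup X]

/-- `f` has modulus of continuity `logModulus`, up to a constant. -/
def HasLogModulus (f : ℝ → X) : Prop := ∃ C, 0 ≤ C ∧ ∀ t s, ‖f t - f s‖ ≤ C * logModulus |t - s|

theorem HasLogModulus.continuous {f : ℝ → X} (hf : HasLogModulus f) : Continuous f := by
  obtain ⟨C, _, hC⟩ := hf
  rw [continuous_iff_continuousAt]
  intro t
  rw [ContinuousAt, tendsto_iff_norm_sub_tendsto_zero]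
  have h1 : Tendsto (fun s => |s - t|) (𝓝 t) (𝓝[≥] 0) := by
    refine tendsto_nhdsWithin_iff.2 ⟨?_, Eventually.of_forall fun s => mem_Ici.2 (abs_nonneg _)⟩
    have : Continuous fun s => |s - t| := by fun_prop
    simpa using this.tendsto t
  have h2 : Tendsto (fun s => C * logModulus |s - t|) (𝓝 t) (𝓝 0) := by
    simpa using (tendsto_logModulus.comp h1).const_mul C
  exact squeeze_zero (fun s => norm_nonneg _) (fun s => hC s t) h2

/-- The primitive `(-log h)^(1-β) / (β-1)` stays bounded at `0` because `β > 1`. -/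
theorem integrableOn_abs_log_rpow_mul_inv {β : ℝ} (hβ : 1 < β) :
    IntegrableOn (fun h => |Real.log h| ^ (-β) * h⁻¹) (Ioc 0 (1 / 4)) := by
  have hb : 0 < β - 1 := by linarith
  have key := intervalIntegral.integrableOn_deriv_of_nonneg (a := 0) (b := 1 / 4)
    (g := fun h => (-Real.log h) ^ (-(β - 1)) / (β - 1))
    (g' := fun h => (-Real.log h) ^ (-β) * h⁻¹) ?_ ?_ ?_
  · refine key.congr_fun (fun h hh => ?_) measurableSet_Ioc
    have : Real.log h < 0 := Real.log_neg hh.1 (by linarith [hh.2])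
    simp only [abs_of_neg this]
  · intro h hh
    rcases hh.1.eq_or_lt with rfl | h0
    -- The conventions `log 0 = 0` and `0 ^ r = 0` for `r ≠ 0` give the primitive the value `0` at
    -- `0`, which is its limit there.
    · rw [ContinuousWithinAt, Real.log_zero, neg_zero, Real.zero_rpow (by linarith), zero_div]
      have h1 : Tendsto (fun h => (-Real.log h) ^ (-(β - 1)) / (β - 1)) (𝓝[>] 0) (𝓝 0) := by
        have := ((tendsto_rpow_neg_atTop hb).comp
          (tendsto_neg_atBot_atTop.comp Real.tendsto_log_nhdsGT_zero)).div_const (β - 1)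
        simpa [Function.comp_def] using this
      have h2 : 𝓝[Icc 0 (1 / 4)] (0 : ℝ) ≤ 𝓝[>] 0 ⊔ pure 0 := by
        rw [sup_comm, ← nhdsWithin_singleton, ← nhdsWithin_union]
        exact nhdsWithin_mono _ fun x hx => (by
          rcases hx.1.eq_or_lt with h | h
          · exact Or.inl h.symm
          · exact Or.inr h)
      refine Tendsto.mono_left (h1.sup ?_) h2
      have h3 := tendsto_pure_pure (fun h => (-Real.log h) ^ (-(β - 1)) / (β - 1)) 0
      rw [Real.log_zero, neg_zero, Real.zero_rpow (by linarith), zero_div] at h3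
      exact h3.mono_right (pure_le_nhds 0)
    · have : Real.log h < 0 := Real.log_neg h0 (by linarith [hh.2])
      refine ContinuousAt.continuousWithinAt ?_
      have hne : (-Real.log) h ≠ 0 := by simp only [Pi.neg_apply]; linarith
      exact ((Real.continuousAt_log h0.ne').neg.rpow_const (Or.inl hne)).div_const _
  · intro h hh
    have h0 : 0 < h := hh.1
    have hl : Real.log h < 0 := Real.log_neg h0 (by linarith [hh.2])
    have := (((Real.hasDerivAt_log h0.ne').neg).rpow_const (p := -(β - 1))
      (Or.inl (by simp; exact ⟨h0.ne', by linarith [hh.2], by linarith⟩))).div_const (β - 1)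
    refine this.congr_deriv ?_
    rw [show -(β - 1) - 1 = -β by ring]
    simp only [Pi.neg_apply]
    field_simp
  · intro h hh
    have hl : Real.log h < 0 := Real.log_neg hh.1 (by linarith [hh.2])
    have : 0 ≤ -Real.log h := by linarith
    have := hh.1
    positivity

/-- Below `1/4` the powers of `h` cancel down to `|log h|^(-q/2) / h`, integrable since `q / 2 > 1`;
beyond `1/4` the integrand is bounded. -/
theorem lintegral_logModulus_lt_top (T C : ℝ) (hC : 0 ≤ C) {q : ℝ} (hq : 2 < q) :
    ∫⁻ h in Ioc 0 T, ENNReal.ofReal (C * logModulus h) ^ q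
      / ENNReal.ofReal (h ^ (1 + 1 / 2 * q)) < ∞ := by
  set Ψ : ℝ → ℝ≥0∞ := fun h => ENNReal.ofReal (C * logModulus h) ^ q
      / ENNReal.ofReal (h ^ (1 + 1 / 2 * q)) with hΨ
  have hsub : Ioc 0 T ⊆ Ioo 0 (1 / 4) ∪ Icc (1 / 4) T := by
    intro x hx
    rcases lt_or_ge x (1 / 4) with h | h
    · exact Or.inl ⟨hx.1, h⟩
    · exact Or.inr ⟨h, hx.2⟩
  have hΨr : ∀ h, 0 < h → Ψ h = ENNReal.ofReal ((C * logModulus h) ^ q / h ^ (1 + 1 / 2 * q)) := by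
    intro h h0
    simp only [hΨ]
    rw [ENNReal.ofReal_div_of_pos (by positivity), ENNReal.ofReal_rpow_of_nonneg
      (mul_nonneg hC (logModulus_nonneg h)) (by linarith)]
  refine (lintegral_mono_set hsub).trans_lt ((lintegral_union_le _ _ _).trans_lt
    (ENNReal.add_lt_top.2 ⟨?_, ?_⟩))
  · have hi : IntegrableOn (fun h => C ^ q * (|Real.log h| ^ (-(q / 2)) * h⁻¹)) (Ioo 0 (1 / 4)) :=
      ((integrableOn_abs_log_rpow_mul_inv (β := q / 2) (by linarith)).mono_set
        Ioo_subset_Ioc_self).const_mul _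
    refine lt_of_eq_of_lt (setLIntegral_congr_fun measurableSet_Ioo fun h hh => ?_)
      hi.lintegral_lt_top
    have h0 := hh.1
    have hl : 0 < |Real.log h| := zero_lt_one.trans_le (one_le_abs_log hh.1 hh.2)
    change Ψ h = _
    rw [hΨr h h0, logModulus, if_pos hh.2]
    congr 1
    rw [Real.mul_rpow hC (Real.sqrt_nonneg _), Real.sqrt_eq_rpow, ← Real.rpow_mul (by positivity),
      Real.div_rpow h0.le hl.le, Real.rpow_add h0, Real.rpow_one, Real.rpow_neg hl.le,
      show q / 2 = 1 / 2 * q by ring]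
    have := Real.rpow_pos_of_pos h0 (1 / 2 * q)
    have := Real.rpow_pos_of_pos hl (1 / 2 * q)
    field_simp
  · refine (setLIntegral_mono measurable_const (g := fun _ => ENNReal.ofReal
      (C ^ q / (1 / 4) ^ (1 + 1 / 2 * q))) fun h hh => ?_).trans_lt ?_
    · have h0 : 0 < h := by linarith [hh.1]
      refine (hΨr h h0).le.trans ?_
      have := logModulus_nonneg h
      gcongr
      · exact mul_le_of_le_one_right hC (logModulus_le_one h0.le)
      · exact hh.1
    · rw [setLIntegral_const]
      exact ENNReal.mul_lt_top ENNReal.ofReal_lt_top (by simp)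

theorem HasLogModulus.memFracSobolev [NormedSpace ℝ X] {f : ℝ → X} (hf : HasLogModulus f) (T : ℝ)
    {q : ℝ} (hq : 2 < q) : MemFracSobolev T (1 / 2) q f := by
  refine ⟨hf.continuous.continuousOn.aestronglyMeasurable_of_isCompact isCompact_Icc
    measurableSet_Icc, ?_⟩
  obtain ⟨C, hC0, hC⟩ := hf
  refine ENNReal.rpow_lt_top_of_nonneg (by positivity) (ne_of_lt ?_)
  set Ψ : ℝ → ℝ≥0∞ := fun h => ENNReal.ofReal (C * logModulus h) ^ q
      / ENNReal.ofReal (h ^ (1 + 1 / 2 * q)) with hΨ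
  set A := ∫⁻ h in Ioc 0 T, Ψ h with hA
  have hAlt : A < ∞ := lintegral_logModulus_lt_top T C hC0 hq
  have hmlog : Measurable logModulus := by
    unfold logModulus
    exact Measurable.ite measurableSet_Iio (by fun_prop) measurable_const
  -- The majorant depends only on `|t - s|`. Extended by zero, it bounds the inner integral by
  -- translation and reflection invariance on the line.
  set G : ℝ → ℝ≥0∞ := (Ioc 0 T).indicator Ψ with hG
  have hGm : Measurable G := by
    refine Measurable.indicator ?_ measurableSet_Ioc
    fun_prop
  have hGA : ∫⁻ h, G h = A := lintegral_indicator measurableSet_Ioc _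
  have hpt : ∀ t ∈ Icc 0 T, ∀ s ∈ Icc 0 T,
      ‖f t - f s‖ₑ ^ q / ENNReal.ofReal (|t - s| ^ (1 + 1 / 2 * q)) ≤ G (t - s) + G (s - t) := by
    intro t ht s hs
    have h1 : ‖f t - f s‖ₑ ^ q / ENNReal.ofReal (|t - s| ^ (1 + 1 / 2 * q)) ≤ Ψ |t - s| := by
      simp only [hΨ]
      gcongr
      rw [← ofReal_norm]
      exact ENNReal.ofReal_le_ofReal (hC t s)
    rcases lt_trichotomy t s with h | h | h
    · refine h1.trans (le_add_left ?_)
      rw [abs_of_neg (by linarith), neg_sub, hG, indicator_of_mem]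
      exact ⟨by linarith, by linarith [ht.1, hs.2]⟩
    · subst h
      simp [show (0 : ℝ) < q by linarith]
    · refine h1.trans (le_add_right ?_)
      rw [abs_of_pos (by linarith), hG, indicator_of_mem]
      exact ⟨by linarith, by linarith [hs.1, ht.2]⟩
  calc ∫⁻ t in Icc 0 T, ∫⁻ s in Icc 0 T,
        ‖f t - f s‖ₑ ^ q / ENNReal.ofReal (|t - s| ^ (1 + 1 / 2 * q))
      ≤ ∫⁻ t in Icc 0 T, 2 * A := by
        refine setLIntegral_mono measurable_const fun t ht => ?_
        calc ∫⁻ s in Icc 0 T, ‖f t - f s‖ₑ ^ q / ENNReal.ofReal (|t - s| ^ (1 + 1 / 2 * q))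
            ≤ ∫⁻ s in Icc 0 T, (G (t - s) + G (s - t)) :=
              setLIntegral_mono (by fun_prop) fun s hs => hpt t ht s hs
          _ ≤ ∫⁻ s, (G (t - s) + G (s - t)) := setLIntegral_le_lintegral _ _
          _ = 2 * A := by
              rw [lintegral_add_left (by fun_prop), lintegral_sub_left_eq_self G,
                lintegral_sub_right_eq_self G, hGA, two_mul]
    _ < ∞ := by
        rw [setLIntegral_const]
        exact ENNReal.mul_lt_top (ENNReal.mul_lt_top (by simp) hAlt) (by simp)

end Modulus

section ModulusAlgebra

variable {X Y : Type*} [NormedAddCommGroup X] [NormedAddCommGroup Y]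

theorem HasLogModulus.of_le {f : ℝ → X} {g : ℝ → Y} (hf : HasLogModulus f) {C : ℝ} (hC : 0 ≤ C)
    (h : ∀ t s, ‖g t - g s‖ ≤ C * ‖f t - f s‖) : HasLogModulus g := by
  obtain ⟨D, hD, hD'⟩ := hf
  refine ⟨C * D, by positivity, fun t s => (h t s).trans ?_⟩
  rw [mul_assoc]
  gcongr
  exact hD' t s

theorem HasLogModulus.of_le_add {Z : Type*} [NormedAddCommGroup Z] {f : ℝ → X} {g : ℝ → Y}
    {k : ℝ → Z} (hf : HasLogModulus f) (hg : HasLogModulus g) {C : ℝ} (hC : 0 ≤ C)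
    (h : ∀ t s, ‖k t - k s‖ ≤ C * (‖f t - f s‖ + ‖g t - g s‖)) : HasLogModulus k := by
  obtain ⟨D, hD, hD'⟩ := hf
  obtain ⟨E, hE, hE'⟩ := hg
  refine ⟨C * (D + E), by positivity, fun t s => (h t s).trans ?_⟩
  rw [mul_assoc, add_mul]
  gcongr
  · exact hD' t s
  · exact hE' t s

theorem HasLogModulus.sub {f g : ℝ → X} (hf : HasLogModulus f) (hg : HasLogModulus g) :
    HasLogModulus (fun t => f t - g t) :=
  hf.of_le_add hg zero_le_one fun t s => by
    rw [one_mul, sub_sub_sub_comm]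
    exact norm_sub_le _ _

end ModulusAlgebra

/-! ### A form with prescribed values along a curve -/

section Form

variable {V : Type*} [NormedAddCommGroup V] [InnerProductSpace ℂ V]

/-- The operator `v ↦ l v + κ⁻¹ (v | k) k`. -/
def rankOnePerturbation (l κ : ℝ) (k : V) : V →L[ℂ] V :=
  (l : ℂ) • ContinuousLinearMap.id ℂ V + ((κ⁻¹ : ℝ) : ℂ) • InnerProductSpace.rankOne ℂ k k

theorem rankOnePerturbation_apply (l κ : ℝ) (k v : V) :
    rankOnePerturbation l κ k v = (l : ℂ) • v + ((κ⁻¹ : ℝ) : ℂ) • (inner ℂ k v • k) := rfl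

theorem inner_rankOnePerturbation (l κ : ℝ) (k v w : V) :
    inner ℂ v (rankOnePerturbation l κ k w)
      = l * inner ℂ v w + ((κ⁻¹ : ℝ) : ℂ) * (inner ℂ k w * inner ℂ v k) := by
  simp only [rankOnePerturbation_apply, inner_add_right, inner_smul_right]

theorem inner_rankOnePerturbation_symm (l κ : ℝ) (k v w : V) :
    inner ℂ v (rankOnePerturbation l κ k w)
      = starRingEnd ℂ (inner ℂ w (rankOnePerturbation l κ k v)) := by
  simp only [inner_rankOnePerturbation, map_add, map_mul, Complex.conj_ofReal, inner_conj_symm]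
  ring

theorem le_re_inner_rankOnePerturbation (l : ℝ) {κ : ℝ} (hκ : 0 < κ) (k v : V) :
    l * ‖v‖ ^ 2 ≤ (inner ℂ v (rankOnePerturbation l κ k v)).re := by
  have h1 : inner ℂ v v = ((‖v‖ ^ 2 : ℝ) : ℂ) := by
    rw [inner_self_eq_norm_sq_to_K]; norm_cast
  have h2 : inner ℂ k v * inner ℂ v k = ((‖inner ℂ k v‖ ^ 2 : ℝ) : ℂ) := by
    rw [← inner_conj_symm v k, Complex.mul_conj, Complex.normSq_eq_norm_sq]
  rw [inner_rankOnePerturbation, h1, h2]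
  norm_cast
  have : 0 ≤ κ⁻¹ * ‖inner ℂ k v‖ ^ 2 := by positivity
  linarith

/-- The normalisation `κ = (k | u)` makes the rank-one term send `u` to `k`, so the value at `u` can
be prescribed without losing symmetry or the lower bound `l`. -/
theorem rankOnePerturbation_apply_eq (l : ℝ) {κ : ℝ} (hκ : 0 < κ) {k u : V}
    (h : inner ℂ k u = (κ : ℂ)) : rankOnePerturbation l κ k u = (l : ℂ) • u + k := by
  have : (κ : ℂ) ≠ 0 := by exact_mod_cast hκ.ne'
  rw [rankOnePerturbation_apply, h, smul_smul]
  simp [this]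

theorem norm_rankOnePerturbation_le {l κ κ₀ M : ℝ} (hl : 0 ≤ l) (hκ₀ : 0 < κ₀) (hκ : κ₀ ≤ κ)
    {k : V} (hk : ‖k‖ ≤ M) : ‖rankOnePerturbation l κ k‖ ≤ l + κ₀⁻¹ * (M * M) := by
  have hκ' : 0 < κ := hκ₀.trans_le hκ
  have hM : 0 ≤ M := (norm_nonneg k).trans hk
  refine (norm_add_le _ _).trans (add_le_add ?_ ?_)
  · rw [norm_smul, Complex.norm_real, Real.norm_of_nonneg hl]
    exact mul_le_of_le_one_right hl ContinuousLinearMap.norm_id_le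
  · rw [norm_smul, Complex.norm_real, Real.norm_of_nonneg (by positivity),
      InnerProductSpace.norm_rankOne]
    gcongr

theorem norm_rankOnePerturbation_sub_le (l : ℝ) {κ κ' κ₀ M : ℝ} (hκ₀ : 0 < κ₀) (hκ : κ₀ ≤ κ)
    (hκ' : κ₀ ≤ κ') {k k' : V} (hk : ‖k‖ ≤ M) (hk' : ‖k'‖ ≤ M) :
    ‖rankOnePerturbation l κ k - rankOnePerturbation l κ' k'‖
      ≤ (κ₀⁻¹ * κ₀⁻¹ * (M * M) + κ₀⁻¹ * (2 * M)) * (‖κ - κ'‖ + ‖k - k'‖) := by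
  have p1 : 0 < κ := hκ₀.trans_le hκ
  have p2 : 0 < κ' := hκ₀.trans_le hκ'
  have hM : 0 ≤ M := (norm_nonneg k).trans hk
  have e : rankOnePerturbation l κ k - rankOnePerturbation l κ' k'
      = ((κ⁻¹ - κ'⁻¹ : ℝ) : ℂ) • InnerProductSpace.rankOne ℂ k k
        + ((κ'⁻¹ : ℝ) : ℂ) • (InnerProductSpace.rankOne ℂ (k - k') k
          + InnerProductSpace.rankOne ℂ k' (k - k')) := by
    ext v
    simp only [sub_apply, rankOnePerturbation_apply,
      add_apply, smul_apply,
      InnerProductSpace.rankOne_apply, inner_sub_left]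
    push_cast
    module
  rw [e]
  have h1 : ‖κ⁻¹ - κ'⁻¹‖ ≤ κ₀⁻¹ * κ₀⁻¹ * ‖κ - κ'‖ := by
    rw [inv_sub_inv p1.ne' p2.ne', norm_div, norm_mul, Real.norm_of_nonneg p1.le,
      Real.norm_of_nonneg p2.le, ← norm_neg (κ' - κ), neg_sub, div_eq_mul_inv, mul_comm, mul_inv]
    gcongr
  refine (norm_add_le _ _).trans ?_
  rw [norm_smul, norm_smul, Complex.norm_real, Complex.norm_real, InnerProductSpace.norm_rankOne,
    Real.norm_of_nonneg (show 0 ≤ κ'⁻¹ by positivity)]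
  have h2 : ‖InnerProductSpace.rankOne ℂ (k - k') k + InnerProductSpace.rankOne ℂ k' (k - k')‖
      ≤ 2 * M * ‖k - k'‖ := by
    refine (norm_add_le _ _).trans ?_
    rw [InnerProductSpace.norm_rankOne, InnerProductSpace.norm_rankOne]
    have := norm_nonneg (k - k')
    nlinarith
  calc ‖κ⁻¹ - κ'⁻¹‖ * (‖k‖ * ‖k‖) + κ'⁻¹ * _
      ≤ κ₀⁻¹ * κ₀⁻¹ * ‖κ - κ'‖ * (M * M) + κ₀⁻¹ * (2 * M * ‖k - k'‖) := by gcongr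
    _ ≤ κ₀⁻¹ * κ₀⁻¹ * ‖κ - κ'‖ * (M * M) + κ₀⁻¹ * (2 * M * ‖k - k'‖)
        + (κ₀⁻¹ * κ₀⁻¹ * (M * M) * ‖k - k'‖ + κ₀⁻¹ * (2 * M) * ‖κ - κ'‖) :=
      le_add_of_nonneg_right (by positivity)
    _ = _ := by ring

/-- As an inner product of bounded curves, `κ` inherits their modulus; the bound `κ₀ ≤ κ` keeps
inversion Lipschitz. -/
theorem HasLogModulus.rankOnePerturbation {k u : ℝ → V} (hk : HasLogModulus k)
    (hu : HasLogModulus u) {M : ℝ} (hkM : ∀ t, ‖k t‖ ≤ M) (huM : ∀ t, ‖u t‖ ≤ M) (l : ℝ)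
    {κ : ℝ → ℝ} {κ₀ : ℝ} (hκ : ∀ t, inner ℂ (k t) (u t) = (κ t : ℂ)) (hκ₀ : 0 < κ₀)
    (hκ₁ : ∀ t, κ₀ ≤ κ t) : HasLogModulus fun t => rankOnePerturbation l (κ t) (k t) := by
  have hM : 0 ≤ M := (norm_nonneg _).trans (huM 0)
  have h1 : HasLogModulus κ := by
    refine hk.of_le_add hu hM fun t s => ?_
    have e : ((κ t - κ s : ℝ) : ℂ) = inner ℂ (k t - k s) (u t) + inner ℂ (k s) (u t - u s) := by
      push_cast
      rw [← hκ, ← hκ, inner_sub_left, inner_sub_right]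
      ring
    rw [← Complex.norm_real, e, mul_add]
    refine (norm_add_le _ _).trans (add_le_add ?_ ?_)
    · refine (norm_inner_le_norm _ _).trans ?_
      rw [mul_comm]
      gcongr
      exact huM t
    · refine (norm_inner_le_norm _ _).trans ?_
      gcongr
      exact hkM s
  exact h1.of_le_add hk (by positivity) fun t s =>
    norm_rankOnePerturbation_sub_le l hκ₀ (hκ₁ t) (hκ₁ s) (hkM t) (hkM s)

variable [CompleteSpace V]

theorem isStrictlyPositive_rankOnePerturbation {l κ : ℝ} (hl : 0 < l) (hκ : 0 < κ) (k : V) :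
    IsStrictlyPositive (rankOnePerturbation l κ k) := by
  have h1 : IsStrictlyPositive (algebraMap ℝ (V →L[ℂ] V) l) := by
    rw [IsStrictlyPositive.iff_of_unital]
    exact ⟨algebraMap_nonneg _ hl.le, (isUnit_iff_ne_zero.2 hl.ne').map _⟩
  refine h1.of_le ?_
  rw [← sub_nonneg, ContinuousLinearMap.nonneg_iff_isPositive]
  have e : rankOnePerturbation l κ k - algebraMap ℝ (V →L[ℂ] V) l = rankOnePerturbation 0 κ k := by
    ext v
    rw [sub_apply, rankOnePerturbation_apply, rankOnePerturbation_apply,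
      Algebra.algebraMap_eq_smul_one]
    simp
  rw [e, ContinuousLinearMap.isPositive_def']
  constructor
  · rw [ContinuousLinearMap.isSelfAdjoint_iff_isSymmetric]
    intro v w
    change inner ℂ (rankOnePerturbation 0 κ k v) w = inner ℂ v (rankOnePerturbation 0 κ k w)
    rw [inner_rankOnePerturbation_symm, inner_conj_symm]
  · intro v
    have := le_re_inner_rankOnePerturbation 0 hκ k v
    rw [zero_mul] at this
    rw [ContinuousLinearMap.reApplyInnerSelf_apply, inner_re_symm]
    exact this

end Form

/-! ### From a curve in `V` to a form without maximal regularity -/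

section Counterexample

variable {V H : Type*}
  [NormedAddCommGroup V] [InnerProductSpace ℂ V]
  [NormedAddCommGroup H] [InnerProductSpace ℂ H]

theorem traceNorm_zero {j : V →L[ℂ] H} (b : SesqForm V) {p : ℝ≥0∞} : traceNorm j b p 0 = 0 := by
  have h : ∀ s, kFunctional j b s 0 = 0 := by
    intro s
    refine le_antisymm ?_ bot_le
    refine (iInf_le _ 0).trans ((iInf_le _ 0).trans ((iInf_le _ ⟨0, by simp, by simp⟩).trans ?_))
    simp
  simp [traceNorm, h]

variable [CompleteSpace V] [CompleteSpace H]

/-- A curve in `V` that is differentiable in `V'` with derivative outside of `H` gives rise to a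
form for which maximal regularity fails. -/
theorem exists_form_of_curve {j : V →L[ℂ] H} (hj : Function.Injective j) {u p : ℝ → V}
    (hu : HasLogModulus u) (hp : HasLogModulus p) {C : ℝ} (huC : ∀ t, ‖u t‖ ≤ C)
    (hpC : ∀ t, ‖p t‖ ≤ C) (hder : ∀ t, HasDerivAt (fun τ => gramOp j (u τ)) (p t) t)
    (himg : ∀ t, 0 ≤ t → p t ∉ range j.adjoint) (hreal : ∀ t, (inner ℂ (p t) (u t)).im = 0)
    {γ : ℝ} (hγ : 0 < γ) (hγu : ∀ t, γ ≤ ‖j (u t)‖ ^ 2 - (inner ℂ (p t) (u t)).re)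
    {T : ℝ} (hT : 0 < T) :
    ∃ u' : ℝ → AntiDual V,
      ContinuousOn u' (Icc 0 T) ∧
      (∀ t ∈ Icc (0 : ℝ) T,
        HasDerivWithinAt (fun τ => toAntiDual j (j (u τ))) (u' t) (Icc 0 T) t ∧
        u' t ∉ range (toAntiDual j)) ∧
      ∃ a : ℝ → SesqForm V,
        IsBoundedCoercive T a ∧ IsSymmetricForm T a ∧
        (∀ q : ℝ, 2 < q → MemFracSobolev T (1 / 2) q a) ∧
        (∀ t ∈ Icc (0 : ℝ) T, u' t + a t (u t) = toAntiDual j (j (u t))) ∧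
        IsIntegratedSolution j T a (fun t => j (u t)) (j (u 0)) u ∧
        (∀ p : ℝ≥0∞, 1 ≤ p → ¬ HasMaximalRegularity j T p a) ∧
        ∃ f : ℝ → V, MemLp f ⊤ (volume.restrict (Icc (0 : ℝ) T)) ∧
          ∀ p : ℝ≥0∞, 1 ≤ p → ¬ ∃ v v' g : ℝ → H,
            IsMaxRegSolution j T p a (fun t => j (f t)) 0 v v' g := by
  have hC0 : 0 ≤ C := (norm_nonneg _).trans (huC 0)
  -- Small enough that `l ‖u‖² ≤ γ / 2`, which leaves `κ ≥ γ / 2`.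
  set l : ℝ := γ / (2 * (C ^ 2 + 1)) with hl
  have hl0 : 0 < l := by positivity
  set k : ℝ → V := fun t => gramOp j (u t) - p t - (l : ℂ) • u t with hk
  set κ : ℝ → ℝ := fun t => ‖j (u t)‖ ^ 2 - (inner ℂ (p t) (u t)).re - l * ‖u t‖ ^ 2 with hκ
  have hκk : ∀ t, inner ℂ (k t) (u t) = (κ t : ℂ) := by
    intro t
    have h1 : inner ℂ (p t) (u t) = (((inner ℂ (p t) (u t)).re : ℝ) : ℂ) :=
      Complex.ext (by simp) (by simp [hreal])
    have h2 : inner ℂ (gramOp j (u t)) (u t) = ((‖j (u t)‖ ^ 2 : ℝ) : ℂ) := by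
      rw [← inner_conj_symm, inner_gramOp, inner_self_eq_norm_sq_to_K]
      simp
    have h3 : inner ℂ (u t) (u t) = ((‖u t‖ ^ 2 : ℝ) : ℂ) := by
      rw [inner_self_eq_norm_sq_to_K]; norm_cast
    simp only [hk, hκ, inner_sub_left, inner_smul_left, Complex.conj_ofReal]
    rw [h2, h3, Complex.ofReal_sub, Complex.ofReal_sub, Complex.ofReal_mul, ← h1]
  have hκ₀ : ∀ t, γ / 2 ≤ κ t := by
    intro t
    have h1 : l * ‖u t‖ ^ 2 ≤ γ / 2 := by
      have h2 : ‖u t‖ ^ 2 ≤ C ^ 2 := by gcongr; exact huC t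
      calc l * ‖u t‖ ^ 2 ≤ l * (C ^ 2 + 1) := by gcongr; linarith
        _ = γ / 2 := by rw [hl]; field_simp
    have := hγu t
    simp only [hκ]
    linarith
  have hκp : ∀ t, 0 < κ t := fun t => (half_pos hγ).trans_le (hκ₀ t)
  set M : ℝ := ‖gramOp j‖ * C + C + l * C + C with hM
  have huM : ∀ t, ‖u t‖ ≤ M := fun t => (huC t).trans (by
    have : 0 ≤ ‖gramOp j‖ * C + C + l * C := by positivity
    linarith)
  have hkM : ∀ t, ‖k t‖ ≤ M := by
    intro t
    have h1 : ‖gramOp j (u t)‖ ≤ ‖gramOp j‖ * C :=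
      ((gramOp j).le_opNorm _).trans (by gcongr; exact huC t)
    have h2 : ‖(l : ℂ) • u t‖ ≤ l * C := by
      rw [norm_smul, Complex.norm_real, Real.norm_of_nonneg hl0.le]
      gcongr
      exact huC t
    have h3 := norm_sub_le (gramOp j (u t) - p t) ((l : ℂ) • u t)
    have h4 := norm_sub_le (gramOp j (u t)) (p t)
    have h5 := hpC t
    simp only [hk, hM]
    linarith
  have hkm : HasLogModulus k := by
    refine HasLogModulus.sub (HasLogModulus.sub ?_ hp) ?_
    · exact hu.of_le (norm_nonneg (gramOp j)) fun t s => by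
        rw [← map_sub]; exact (gramOp j).le_opNorm _
    · exact hu.of_le (norm_nonneg (l : ℂ)) fun t s => by
        rw [← smul_sub, norm_smul]
  set B : ℝ → V →L[ℂ] V := fun t => rankOnePerturbation l (κ t) (k t) with hB
  have hBm : HasLogModulus B := hkm.rankOnePerturbation hu hkM huM l hκk (half_pos hγ) hκ₀
  have hBu : ∀ t, p t + B t (u t) = gramOp j (u t) := by
    intro t
    have h1 : B t (u t) = (l : ℂ) • u t + k t := rankOnePerturbation_apply_eq l (hκp t) (hκk t)
    rw [h1, hk, add_sub_cancel, add_sub_cancel]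
  have hBco : ∀ t v, l * ‖v‖ ^ 2 ≤ (inner ℂ v (B t v)).re := fun t v =>
    le_re_inner_rankOnePerturbation l (hκp t) (k t) v
  have hBM : ∀ t, ‖B t‖ ≤ l + (γ / 2)⁻¹ * (M * M) := fun t =>
    norm_rankOnePerturbation_le hl0.le (half_pos hγ) (hκ₀ t) (hkM t)
  have hD : ∀ v, j.adjoint (j v) = gramOp j v := fun v => rfl
  set J : V →L[ℂ] AntiDual V := (riesz V : V →L[ℂ] AntiDual V) with hJ
  set a : ℝ → SesqForm V := fun t => J ∘L B t with ha
  -- The right-hand side solved by `t u(t)`; the factor `t` produces zero initial value.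
  set f : ℝ → V := fun t => u t + t • u t with hf
  have hfc : Continuous f := by
    have := hu.continuous
    fun_prop
  have hfLp : MemLp f ⊤ (volume.restrict (Icc (0 : ℝ) T)) := by
    refine memLp_top_of_bound (hfc.aestronglyMeasurable) (C + T * C) ?_
    filter_upwards [ae_restrict_mem measurableSet_Icc] with t ht
    refine (norm_add_le _ _).trans ?_
    rw [norm_smul, Real.norm_of_nonneg ht.1]
    have h1 := huC t
    have h2 := ht.2
    gcongr
  have hnone : ∀ q : ℝ≥0∞, 1 ≤ q → ¬ ∃ v v' g : ℝ → H,
      IsMaxRegSolution j T q a (fun t => j (f t)) 0 v v' g := by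
    rintro q hq ⟨v, v', g, hv⟩
    have h := hv.ae_adjoint_deriv_eq hj hl0 hBco hBM (w := fun t => t • u t)
      (p := fun t => gramOp j (u t) + t • p t) (C := T * C) ?_ (by simp) ?_ ?_ ?_ hq
    · have hne : ∀ᵐ t ∂(volume.restrict (Icc (0 : ℝ) T)), t ≠ 0 :=
        ae_restrict_of_ae (Measure.ae_ne volume 0)
      have : (ae (volume.restrict (Icc (0 : ℝ) T))).NeBot := by
        rw [ae_restrict_neBot]
        simpa using hT
      obtain ⟨t, ⟨ht, ht0⟩, htm⟩ :=
        ((h.and hne).and (ae_restrict_mem measurableSet_Icc)).exists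
      -- Uniqueness gives `j* v' = j* j u + t p`; dividing by `t ≠ 0` would put `p t` into the range
      -- of `j*`.
      refine himg t htm.1 ⟨(t : ℂ)⁻¹ • (v' t - j (u t)), ?_⟩
      have ht0' : (t : ℂ) ≠ 0 := by exact_mod_cast ht0
      rw [map_smul, map_sub, ht, hD, add_sub_cancel_left, ← Complex.coe_smul, smul_smul,
        inv_mul_cancel₀ ht0', one_smul]
    · intro t ht
      rw [norm_smul, Real.norm_of_nonneg ht.1]
      have h1 := huC t
      have h2 := ht.2
      gcongr
    · have := hu.continuous
      have := hp.continuous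
      fun_prop
    · intro t
      have h1 := (hasDerivAt_id t).smul (hder t)
      have e : (fun τ => gramOp j (τ • u τ)) = fun τ : ℝ => id τ • gramOp j (u τ) := by
        funext τ
        rw [ContinuousLinearMap.map_smul_of_tower]
        rfl
      rw [e]
      refine h1.congr_deriv ?_
      simp [add_comm]
    · intro t
      rw [hD, ContinuousLinearMap.map_smul_of_tower, map_add,
        ContinuousLinearMap.map_smul_of_tower, add_assoc, ← smul_add, hBu]
  refine ⟨fun t => J (p t), ?_, ?_, a, ?_, ?_, ?_, ?_, ?_, ?_, f, hfLp, hnone⟩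
  · exact (J.continuous.comp hp.continuous).continuousOn
  · intro t ht
    constructor
    · have := (J.restrictScalars ℝ).hasFDerivAt.comp_hasDerivAt t (hder t)
      refine (this.congr_of_eventuallyEq (Eventually.of_forall fun τ => ?_)).hasDerivWithinAt
      exact toAntiDual_eq_riesz j _
    · rintro ⟨h, hh⟩
      rw [toAntiDual_eq_riesz] at hh
      exact himg t ht.1 ⟨h, (riesz V).injective hh⟩
  · refine ⟨l, l + (γ / 2)⁻¹ * (M * M) + 1, hl0, ?_, fun t _ v w => ⟨hBco t v, ?_⟩⟩
    · have := (norm_nonneg _).trans (hBM 0)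
      linarith
    · change ‖inner ℂ w (B t v)‖ ≤ _
      refine (norm_inner_le_norm _ _).trans ?_
      rw [mul_comm]
      gcongr
      refine ((B t).le_opNorm _).trans ?_
      gcongr
      linarith [hBM t]
  · intro t _ v w
    exact inner_rankOnePerturbation_symm l (κ t) (k t) w v
  · intro q hq
    refine HasLogModulus.memFracSobolev (hBm.of_le zero_le_one fun t s => ?_) T hq
    rw [one_mul, ha, ← ContinuousLinearMap.comp_sub]
    exact ((riesz V).toLinearIsometry.norm_toContinuousLinearMap_comp).le
  · intro t _
    rw [toAntiDual_eq_riesz, hD, ← hBu t, map_add]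
    rfl
  · exact isIntegratedSolution_of_hasDerivAt hj T
      (fun t => isStrictlyPositive_rankOnePerturbation hl0 (hκp t) (k t)) hBm.continuous
      hu.continuous hder (j.continuous.comp hu.continuous) hBu
  · intro q hq hmr
    refine hnone q hq (hmr.1 (fun t => j (f t)) 0 ?_ ?_).1
    · exact (j.comp_memLp' hfLp).mono_exponent le_top
    · rw [traceNorm_zero]
      exact ENNReal.zero_lt_top

end Counterexample

/-! ### The oscillating function is not square integrable -/

section Oscillation

theorem weight_eq_of_mem {x : ℝ} (h0 : 0 < x) (h1 : x ≤ 1 / 2) :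
    weight x = (x * -Real.log x) ^ (-(3 / 2) : ℝ) := by
  rw [weight, abs_of_neg (Real.log_neg h0 (by linarith))]

theorem hasDerivAt_neg_log {x : ℝ} (h0 : 0 < x) :
    HasDerivAt (fun y => -Real.log y) (-x⁻¹) x := (Real.hasDerivAt_log h0.ne').neg

theorem hasDerivAt_mul_neg_log {x : ℝ} (h0 : 0 < x) :
    HasDerivAt (fun y => y * -Real.log y) (-Real.log x - 1) x := by
  refine ((hasDerivAt_id x).mul (hasDerivAt_neg_log h0)).congr_deriv ?_
  simp only [id]
  field_simp
  ring

theorem hasDerivAt_mul_neg_log_rpow {x : ℝ} (h0 : 0 < x) (h1 : x < 1) (r : ℝ) :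
    HasDerivAt (fun y => (y * -Real.log y) ^ r)
      ((-Real.log x - 1) * r * (x * -Real.log x) ^ (r - 1)) x := by
  have hl : Real.log x < 0 := Real.log_neg h0 h1
  exact (hasDerivAt_mul_neg_log h0).rpow_const (Or.inl (mul_pos h0 (by linarith)).ne')

theorem mul_neg_log_le_one {x : ℝ} (h0 : 0 < x) : x * -Real.log x ≤ 1 := by
  have hle : Real.log x⁻¹ ≤ x⁻¹ - 1 := Real.log_le_sub_one_of_pos (inv_pos.2 h0)
  rw [Real.log_inv] at hle
  calc x * -Real.log x ≤ x * (x⁻¹ - 1) := mul_le_mul_of_nonneg_left hle h0.le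
    _ = 1 - x := by field_simp
    _ ≤ 1 := by linarith

/-- The boundary term in the integration by parts of `cos(2 t φ) / c`. -/
def boundaryTerm (t x : ℝ) : ℝ :=
  (x * -Real.log x) ^ (3 / 2 : ℝ) / (3 * t * (-Real.log x - 1))
    * Real.sin (2 * t * (x * -Real.log x) ^ (-(3 / 2) : ℝ))

theorem abs_boundaryTerm_le {t x : ℝ} (ht : 0 < t) (h0 : 0 < x) (h2 : 2 ≤ -Real.log x) :
    |boundaryTerm t x| ≤ 1 / t := by
  have hc0 : 0 < x * -Real.log x := mul_pos h0 (by linarith)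
  have hc1 := mul_neg_log_le_one h0
  rw [boundaryTerm, abs_mul, abs_of_nonneg (div_nonneg (by positivity)
    (mul_nonneg (by positivity) (by linarith)))]
  have h3 : (x * -Real.log x) ^ (3 / 2 : ℝ) ≤ 1 := Real.rpow_le_one hc0.le hc1 (by norm_num)
  have h4 : t ≤ 3 * t * (-Real.log x - 1) := by nlinarith
  calc _ ≤ (1 / t) * 1 := by
        gcongr
        exact Real.abs_sin_le_one _
    _ = 1 / t := mul_one _

/-- With `L = -log x` and `c = x L`, the phase `2 t c^(-3/2)` has derivative `-3 t (L - 1)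
c^(-5/2)`. The amplitude is chosen so that differentiating the sine yields `-cos / c`; `E` is what
remains when the derivative falls on the amplitude, bounded since `L ≥ 2`. -/
theorem exists_hasDerivAt_boundaryTerm {t x : ℝ} (ht : 0 < t) (h0 : 0 < x)
    (h2 : 2 ≤ -Real.log x) :
    ∃ E, |E| ≤ 2 / t ∧ HasDerivAt (boundaryTerm t)
      (-((x * -Real.log x)⁻¹ * Real.cos (2 * t * (x * -Real.log x) ^ (-(3 / 2) : ℝ))) + E) x := by
  have h1 : x < 1 := by
    by_contra h
    have := Real.log_nonneg (not_lt.1 h)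
    linarith
  set L := -Real.log x with hL
  set c := x * L with hc
  have hc0 : 0 < c := mul_pos h0 (by linarith)
  have hc1 : c ≤ 1 := mul_neg_log_le_one h0
  have hL1 : 0 < L - 1 := by linarith
  have d1 := hasDerivAt_mul_neg_log_rpow h0 h1 (3 / 2)
  have d2 : HasDerivAt (fun y => 3 * t * (-Real.log y - 1)) (3 * t * -x⁻¹) x :=
    ((hasDerivAt_neg_log h0).sub_const 1).const_mul (3 * t)
  have d3 := d1.div d2 (by rw [← hL]; positivity)
  have d4 := ((hasDerivAt_mul_neg_log_rpow h0 h1 (-(3 / 2))).const_mul (2 * t)).sin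
  have d5 := d3.mul d4
  simp only [← hL, ← hc] at d5
  set S := Real.sin (2 * t * c ^ (-(3 / 2) : ℝ)) with hS
  set K := Real.cos (2 * t * c ^ (-(3 / 2) : ℝ)) with hK
  set r := c ^ (1 / 2 : ℝ) with hr
  have hr0 : 0 < r := by positivity
  have hr1 : r ≤ 1 := Real.rpow_le_one hc0.le hc1 (by norm_num)
  have e1 : c ^ (3 / 2 : ℝ) = c * r := by
    rw [hr, ← Real.rpow_one_add' hc0.le (by norm_num)]; norm_num
  have e2 : c ^ (3 / 2 - 1 : ℝ) = r := by rw [hr]; norm_num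
  have e3 : c ^ (-(3 / 2) - 1 : ℝ) = (c * c * r)⁻¹ := by
    have : c * c * r = c ^ (5 / 2 : ℝ) := by
      rw [hr, mul_assoc, ← Real.rpow_one_add' hc0.le (by norm_num),
        ← Real.rpow_one_add' hc0.le (by norm_num)]
      norm_num
    rw [this, ← Real.rpow_neg hc0.le]
    norm_num
  refine ⟨(3 / 2 * r + r * L / (L - 1) ^ 2) / (3 * t) * S, ?_, ?_⟩
  · have hS1 : |S| ≤ 1 := Real.abs_sin_le_one _
    have hq : L / (L - 1) ^ 2 ≤ 2 := by
      rw [div_le_iff₀ (by positivity)]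
      nlinarith
    have h3 : 3 / 2 * r + r * L / (L - 1) ^ 2 ≤ 6 := by
      rw [mul_div_assoc]
      have : r * (L / (L - 1) ^ 2) ≤ 1 * 2 := by gcongr
      linarith
    have hnn : 0 ≤ (3 / 2 * r + r * L / (L - 1) ^ 2) / (3 * t) := by
      have : 0 ≤ L := by linarith
      positivity
    rw [abs_mul, abs_of_nonneg hnn]
    calc _ ≤ (6 / (3 * t)) * 1 := by gcongr
      _ = 2 / t := by field_simp; norm_num
  · refine d5.congr_deriv ?_
    simp only [Pi.div_apply, ← hL, ← hc]
    rw [e1, e2, e3]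
    have hcx : c = x * L := hc
    have hLne : L ≠ 0 := by linarith
    have hLm : L - 1 ≠ 0 := hL1.ne'
    field_simp
    linear_combination (2 * r * c * S) * hcx

/-- The function `log (-log x) + boundaryTerm t x` is unbounded at `0` and has derivative `-2 cos² /
c + E`. The summand `1` in the integrand absorbs the bounded error `E`. -/
theorem not_integrableOn_inv_mul_cos_sq {t : ℝ} (ht : 0 ≤ t) :
    ¬ IntegrableOn (fun x => (x * -Real.log x)⁻¹
      * Real.cos (t * (x * -Real.log x) ^ (-(3 / 2) : ℝ)) ^ 2 + 1) (Ioc 0 (1 / 2)) := by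
  have hsmall : ∀ᶠ x in 𝓝[>] (0 : ℝ), 0 < x ∧ 2 ≤ -Real.log x := by
    have := (tendsto_neg_atBot_atTop.comp Real.tendsto_log_nhdsGT_zero).eventually_ge_atTop 2
    filter_upwards [self_mem_nhdsWithin, this] with x h0 h2
    exact ⟨h0, h2⟩
  have hlog : ∀ x : ℝ, 0 < x → 2 ≤ -Real.log x →
      HasDerivAt (fun y => Real.log (-Real.log y)) (-(x * -Real.log x)⁻¹) x := by
    intro x h0 h2
    refine ((hasDerivAt_neg_log h0).log (by linarith)).congr_deriv ?_
    rw [mul_inv]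
    field_simp
  have hloglim : Tendsto (fun y => Real.log (-Real.log y)) (𝓝[>] (0 : ℝ)) atTop :=
    Real.tendsto_log_atTop.comp (tendsto_neg_atBot_atTop.comp Real.tendsto_log_nhdsGT_zero)
  have hk : Ioc (0 : ℝ) (1 / 2) ∈ 𝓝[>] (0 : ℝ) := Ioc_mem_nhdsGT (by norm_num)
  rcases ht.eq_or_lt with rfl | ht
  -- At `t = 0` nothing oscillates and the boundary term would divide by zero; `log (-log x)` alone
  -- suffices.
  · refine not_integrableOn_of_tendsto_norm_atTop_of_deriv_isBigO_filter (𝓝[>] (0 : ℝ)) hk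
      (f := fun y => Real.log (-Real.log y)) ?_ (tendsto_norm_atTop_atTop.comp hloglim) ?_
    · filter_upwards [hsmall] with x hx
      exact (hlog x hx.1 hx.2).differentiableAt
    · refine Asymptotics.IsBigO.of_bound 1 ?_
      filter_upwards [hsmall] with x hx
      have : 0 < (x * -Real.log x)⁻¹ := inv_pos.2 (mul_pos hx.1 (by linarith))
      rw [(hlog x hx.1 hx.2).deriv, norm_neg]
      simp only [zero_mul, Real.cos_zero, one_pow, mul_one, one_mul]
      rw [Real.norm_of_nonneg this.le, Real.norm_of_nonneg (by linarith)]
      linarith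
  · refine not_integrableOn_of_tendsto_norm_atTop_of_deriv_isBigO_filter (𝓝[>] (0 : ℝ)) hk
      (f := fun y => Real.log (-Real.log y) + boundaryTerm t y) ?_ ?_ ?_
    · filter_upwards [hsmall] with x hx
      obtain ⟨E, -, hE⟩ := exists_hasDerivAt_boundaryTerm ht hx.1 hx.2
      exact ((hlog x hx.1 hx.2).add hE).differentiableAt
    · refine tendsto_norm_atTop_atTop.comp (tendsto_atTop_add_right_of_le' _ (-(1 / t)) hloglim ?_)
      filter_upwards [hsmall] with x hx
      exact (abs_le.1 (abs_boundaryTerm_le ht hx.1 hx.2)).1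
    · refine Asymptotics.IsBigO.of_bound (2 + 2 / t) ?_
      filter_upwards [hsmall] with x hx
      obtain ⟨E, hE1, hE⟩ := exists_hasDerivAt_boundaryTerm ht hx.1 hx.2
      have hc : 0 < (x * -Real.log x)⁻¹ := inv_pos.2 (mul_pos hx.1 (by linarith))
      have := ((hlog x hx.1 hx.2).add hE).deriv
      have e : deriv (fun y => Real.log (-Real.log y) + boundaryTerm t y) x = _ := this
      rw [e, mul_assoc 2 t, Real.cos_two_mul]
      set K := Real.cos (t * (x * -Real.log x) ^ (-(3 / 2) : ℝ)) with hK
      set i := (x * -Real.log x)⁻¹ with hi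
      have hp : 0 ≤ i * K ^ 2 := by positivity
      rw [Real.norm_of_nonneg (by linarith : 0 ≤ i * K ^ 2 + 1)]
      have e2 : -i + (-(i * (2 * K ^ 2 - 1)) + E) = -(2 * (i * K ^ 2)) + E := by ring
      rw [e2]
      refine (norm_add_le _ _).trans ?_
      rw [norm_neg, Real.norm_of_nonneg (by positivity), Real.norm_eq_abs]
      have : 0 ≤ 2 / t := by positivity
      nlinarith

/-- The time derivative `∂ₜu(t, ·)` is not square integrable. -/
theorem not_memLp_deriv {t : ℝ} (ht : 0 ≤ t) :
    ¬ MemLp (fun x => ((x * |Real.log x| * (Real.cos (t * weight x) * weight x) : ℝ) : ℂ)) 2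
      baseMeasure := by
  intro h
  have h1 := h.integrable_norm_pow (by norm_num)
  have h2 : IntegrableOn (fun x => (x * -Real.log x)⁻¹
      * Real.cos (t * (x * -Real.log x) ^ (-(3 / 2) : ℝ)) ^ 2 + 1) (Ioc 0 (1 / 2)) := by
    have h3 : IntegrableOn _ (Ioc (0 : ℝ) (1 / 2)) := h1.mono_measure
      (Measure.restrict_mono Ioc_subset_Icc_self le_rfl)
    refine IntegrableOn.add (h3.congr_fun (fun x hx => ?_) measurableSet_Ioc)
      (integrableOn_const (by simp))
    have hl : Real.log x < 0 := Real.log_neg hx.1 (by linarith [hx.2])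
    have hc0 : 0 < x * -Real.log x := mul_pos hx.1 (by linarith)
    simp only [Complex.norm_real, Real.norm_eq_abs]
    rw [sq_abs, weight_eq_of_mem hx.1 hx.2, abs_of_neg hl]
    set c := x * -Real.log x with hc
    set K := Real.cos (t * c ^ (-(3 / 2) : ℝ)) with hK
    have e : (c ^ (-(3 / 2) : ℝ)) ^ 2 = (c ^ 3)⁻¹ := by
      rw [← Real.rpow_natCast, ← Real.rpow_mul hc0.le, ← Real.rpow_natCast c 3,
        ← Real.rpow_neg hc0.le]
      norm_num
    rw [mul_pow c, mul_pow K, e]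
    field_simp
  exact not_integrableOn_inv_mul_cos_sq ht h2

end Oscillation

/-! ### The modulus of continuity of the oscillating functions in the weighted space -/

section Estimate

/-- The coefficient `c(x) = x |log x|`. -/
def coeff (x : ℝ) : ℝ := x * |Real.log x|

theorem weight_eq_coeff (x : ℝ) : weight x = coeff x ^ (-(3 / 2) : ℝ) := rfl

theorem measurable_coeff : Measurable coeff := by unfold coeff; fun_prop

theorem measurable_weight : Measurable weight := by unfold weight; fun_prop

theorem coeff_pos {x : ℝ} (hx : x ∈ Ioc (0 : ℝ) (1 / 2)) : 0 < coeff x :=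
  mul_pos hx.1 (abs_pos.2 (Real.log_neg hx.1 (by linarith [hx.2])).ne)

theorem coeff_le_one {x : ℝ} (hx : x ∈ Ioc (0 : ℝ) (1 / 2)) : coeff x ≤ 1 := by
  rw [coeff, abs_of_neg (Real.log_neg hx.1 (by linarith [hx.2]))]
  exact mul_neg_log_le_one hx.1

theorem weight_pos {x : ℝ} (hx : x ∈ Ioc (0 : ℝ) (1 / 2)) : 0 < weight x :=
  zero_lt_one.trans_le (one_le_weight hx.1 hx.2)

/-- The square of `c min(2, h w)`, multiplied by the weight. -/
def modulusDensity (h x : ℝ) : ℝ := (coeff x * min 2 (h * weight x)) ^ 2 * weight x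

/-- Uses `c² w = √c`; the relevant bound where `h w` is large, near `x = 0`. -/
theorem modulusDensity_le_sqrt {h x : ℝ} (hh : 0 ≤ h) (hx : x ∈ Ioc (0 : ℝ) (1 / 2)) :
    modulusDensity h x ≤ 4 * √(coeff x) := by
  have hc := coeff_pos hx
  have hw := weight_pos hx
  have h1 : coeff x ^ 2 * weight x = √(coeff x) := by
    rw [weight_eq_coeff, Real.sqrt_eq_rpow, ← Real.rpow_natCast, ← Real.rpow_add hc]
    norm_num
  have h2 : 0 ≤ min 2 (h * weight x) := by positivity
  calc modulusDensity h x = (coeff x ^ 2 * weight x) * min 2 (h * weight x) ^ 2 := by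
        rw [modulusDensity]; ring
    _ ≤ (coeff x ^ 2 * weight x) * 2 ^ 2 := by gcongr; exact min_le_left _ _
    _ = 4 * √(coeff x) := by rw [h1]; ring

/-- Uses `c² w³ = c^(-5/2)`; the relevant bound where `h w` is small. -/
theorem modulusDensity_le_rpow {h x : ℝ} (hh : 0 ≤ h) (hx : x ∈ Ioc (0 : ℝ) (1 / 2)) :
    modulusDensity h x ≤ h ^ 2 * coeff x ^ (-(5 / 2) : ℝ) := by
  have hc := coeff_pos hx
  have hw := weight_pos hx
  have h1 : coeff x ^ 2 * weight x ^ 3 = coeff x ^ (-(5 / 2) : ℝ) := by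
    rw [weight_eq_coeff, ← Real.rpow_natCast, ← Real.rpow_natCast, ← Real.rpow_mul hc.le,
      ← Real.rpow_add hc]
    norm_num
  have h2 : 0 ≤ min 2 (h * weight x) := by positivity
  calc modulusDensity h x = (coeff x ^ 2 * weight x) * min 2 (h * weight x) ^ 2 := by
        rw [modulusDensity]; ring
    _ ≤ (coeff x ^ 2 * weight x) * (h * weight x) ^ 2 := by gcongr; exact min_le_right _ _
    _ = h ^ 2 * (coeff x ^ 2 * weight x ^ 3) := by ring
    _ = _ := by rw [h1]

theorem sqrt_coeff_le {x h : ℝ} (hx : x ∈ Ioc (0 : ℝ) (1 / 2)) (hxh : x ≤ h) :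
    √(coeff x) ≤ 2 * h ^ (1 / 4 : ℝ) := by
  have h0 := hx.1
  have h1 := Real.abs_log_mul_self_rpow_lt x (1 / 2) h0 (by linarith [hx.2]) (by norm_num)
  rw [abs_mul, abs_of_pos (Real.rpow_pos_of_pos h0 _)] at h1
  have e : coeff x = x ^ (1 / 2 : ℝ) * (|Real.log x| * x ^ (1 / 2 : ℝ)) := by
    have : x ^ (1 / 2 : ℝ) * x ^ (1 / 2 : ℝ) = x := by rw [← Real.rpow_add h0]; norm_num
    rw [coeff]
    calc x * |Real.log x| = (x ^ (1 / 2 : ℝ) * x ^ (1 / 2 : ℝ)) * |Real.log x| := by rw [this]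
      _ = _ := by ring
  have hh : 0 ≤ h := h0.le.trans hxh
  refine Real.sqrt_le_iff.2 ⟨by positivity, ?_⟩
  rw [e, mul_pow, ← Real.rpow_natCast, ← Real.rpow_natCast (h ^ (1 / 4 : ℝ)), ← Real.rpow_mul hh]
  have h2 : x ^ (1 / 2 : ℝ) ≤ h ^ (1 / 2 : ℝ) := Real.rpow_le_rpow h0.le hxh (by norm_num)
  have h3 : 0 ≤ |Real.log x| * x ^ (1 / 2 : ℝ) := by positivity
  norm_num at h1 h2 h3 ⊢
  have h4 : 0 ≤ h ^ (1 / 2 : ℝ) := by positivity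
  norm_num at h4
  nlinarith

theorem two_rpow_le : (2 : ℝ) ^ (5 / 2 : ℝ) ≤ 6 := by
  rw [show (5 / 2 : ℝ) = 2 + 1 / 2 by norm_num, Real.rpow_add (by norm_num),
    ← Real.sqrt_eq_rpow]
  have : √2 ≤ 3 / 2 := Real.sqrt_le_iff.2 ⟨by norm_num, by norm_num⟩
  norm_num
  linarith

theorem mul_half_rpow_le {x l : ℝ} (hx : 0 < x) (hl : 0 < l) {c : ℝ} (hc : x * (l / 2) ≤ c) :
    c ^ (-(5 / 2) : ℝ) ≤ 6 * l ^ (-(5 / 2) : ℝ) * x ^ (-(5 / 2) : ℝ) := by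
  have h1 : c ^ (-(5 / 2) : ℝ) ≤ (x * (l / 2)) ^ (-(5 / 2) : ℝ) :=
    Real.rpow_le_rpow_of_nonpos (by positivity) hc (by norm_num)
  refine h1.trans ?_
  rw [Real.mul_rpow hx.le (by positivity), Real.div_rpow hl.le (by norm_num), Real.rpow_neg
    (show (0 : ℝ) ≤ 2 by norm_num), div_inv_eq_mul]
  have h2 := two_rpow_le
  calc x ^ (-(5 / 2) : ℝ) * (l ^ (-(5 / 2) : ℝ) * 2 ^ (5 / 2 : ℝ))
      ≤ x ^ (-(5 / 2) : ℝ) * (l ^ (-(5 / 2) : ℝ) * 6) := by gcongr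
    _ = _ := by ring

theorem lintegral_Ioi_rpow {a k : ℝ} (ha : 0 < a) (hk : 0 ≤ k) :
    ∫⁻ x, (Ioi a).indicator (fun x => ENNReal.ofReal (k * x ^ (-(5 / 2) : ℝ))) x
      = ENNReal.ofReal (k * (2 / 3 * a ^ (-(3 / 2) : ℝ))) := by
  rw [lintegral_indicator measurableSet_Ioi, ← ofReal_integral_eq_lintegral_ofReal
    ((integrableOn_Ioi_rpow_of_lt (by norm_num) ha).const_mul k) ?_]
  · rw [integral_const_mul, integral_Ioi_rpow_of_lt (by norm_num) ha]
    congr 2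
    rw [show (-(5 / 2) + 1 : ℝ) = -(3 / 2) by norm_num]
    ring
  · filter_upwards [ae_restrict_mem measurableSet_Ioi] with x hx
    have : 0 < x := ha.trans hx
    positivity

theorem lintegral_Ioc_const {a k : ℝ} (hk : 0 ≤ k) :
    ∫⁻ x, (Ioc 0 a).indicator (fun _ => ENNReal.ofReal k) x = ENNReal.ofReal (k * a) := by
  rw [lintegral_indicator measurableSet_Ioc, setLIntegral_const, Real.volume_Ioc, sub_zero,
    ENNReal.ofReal_mul hk]

/-- The two bounds cross at `h w ≈ 1`, that is `c ≈ h^(2/3)` and `x ≈ δ = h^(2/3) / |log h|`. Each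
side contributes a multiple of `h / |log h|`, provided `|log x|` may be replaced by `|log h|`. That
is legitimate up to a factor `2` for `h < x ≤ h^(1/2)`; outside this range crude bounds give
`h^(5/4)`, which is smaller still. -/
theorem lintegral_modulusDensity_le {h : ℝ} (h0 : 0 < h) (h1 : h < 1 / 4) :
    ∫⁻ x in Ioc 0 (1 / 2), ENNReal.ofReal (modulusDensity h x)
      ≤ ENNReal.ofReal (56 * (h / |Real.log h|)) := by
  set l := |Real.log h| with hl
  have hl1 : 1 ≤ l := one_le_abs_log h0 h1
  have hl0 : 0 < l := by linarith
  have hlog : Real.log h < 0 := Real.log_neg h0 (by linarith)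
  have hl' : l = -Real.log h := abs_of_neg hlog
  set δ := h ^ (2 / 3 : ℝ) / l with hδ
  have hδ0 : 0 < δ := by positivity
  set F1 : ℝ → ℝ≥0∞ := (Ioc 0 h).indicator fun _ => ENNReal.ofReal (8 * h ^ (1 / 4 : ℝ)) with hF1
  set F2 : ℝ → ℝ≥0∞ := (Ioc 0 δ).indicator fun _ => ENNReal.ofReal (4 * h ^ (1 / 3 : ℝ)) with hF2
  set F3 : ℝ → ℝ≥0∞ := (Ioi δ).indicator fun x =>
    ENNReal.ofReal (h ^ 2 * (6 * l ^ (-(5 / 2) : ℝ)) * x ^ (-(5 / 2) : ℝ)) with hF3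
  set F4 : ℝ → ℝ≥0∞ := (Ioi (h ^ (1 / 2 : ℝ))).indicator fun x =>
    ENNReal.ofReal (h ^ 2 * (6 * 1) * x ^ (-(5 / 2) : ℝ)) with hF4
  have m1 : Measurable F1 := measurable_const.indicator measurableSet_Ioc
  have m2 : Measurable F2 := measurable_const.indicator measurableSet_Ioc
  have m3 : Measurable F3 := Measurable.indicator (by fun_prop) measurableSet_Ioi
  have hpt : ∀ x ∈ Ioc (0 : ℝ) (1 / 2),
      ENNReal.ofReal (modulusDensity h x) ≤ F1 x + F2 x + F3 x + F4 x := by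
    intro x hx
    have hx0 := hx.1
    have hxlog : Real.log x < 0 := Real.log_neg hx0 (by linarith [hx.2])
    rcases le_or_gt x h with hxh | hxh
    · have : ENNReal.ofReal (modulusDensity h x) ≤ F1 x := by
        rw [hF1, indicator_of_mem (show x ∈ Ioc 0 h from ⟨hx0, hxh⟩)]
        refine ENNReal.ofReal_le_ofReal ((modulusDensity_le_sqrt h0.le hx).trans ?_)
        linarith [sqrt_coeff_le hx hxh]
      exact this.trans ((le_add_right le_rfl).trans ((le_add_right le_rfl).trans (le_add_right le_rfl)))
    rcases le_or_gt x δ with hxd | hxd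
    · have : ENNReal.ofReal (modulusDensity h x) ≤ F2 x := by
        rw [hF2, indicator_of_mem (show x ∈ Ioc 0 δ from ⟨hx0, hxd⟩)]
        refine ENNReal.ofReal_le_ofReal ((modulusDensity_le_sqrt h0.le hx).trans ?_)
        gcongr
        refine Real.sqrt_le_iff.2 ⟨by positivity, ?_⟩
        have e : (h ^ (1 / 3 : ℝ)) ^ 2 = δ * l := by
          rw [hδ, div_mul_cancel₀ _ hl0.ne', ← Real.rpow_natCast, ← Real.rpow_mul h0.le]
          norm_num
        rw [e, coeff]
        gcongr
        rw [hl', abs_of_neg hxlog]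
        linarith [Real.log_le_log h0 hxh.le]
      exact this.trans ((le_add_left le_rfl).trans ((le_add_right le_rfl).trans (le_add_right le_rfl)))
    rcases le_or_gt x (h ^ (1 / 2 : ℝ)) with hxs | hxs
    · have : ENNReal.ofReal (modulusDensity h x) ≤ F3 x := by
        rw [hF3, indicator_of_mem (show x ∈ Ioi δ from hxd)]
        refine ENNReal.ofReal_le_ofReal ((modulusDensity_le_rpow h0.le hx).trans ?_)
        rw [mul_assoc]
        gcongr
        refine mul_half_rpow_le hx0 hl0 ?_
        rw [coeff]
        gcongr
        rw [hl', abs_of_neg hxlog]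
        have := Real.log_le_log hx0 hxs
        rw [Real.log_rpow h0] at this
        linarith
      exact this.trans ((le_add_left le_rfl).trans (le_add_right le_rfl))
    · have : ENNReal.ofReal (modulusDensity h x) ≤ F4 x := by
        rw [hF4, indicator_of_mem (show x ∈ Ioi (h ^ (1 / 2 : ℝ)) from hxs)]
        refine ENNReal.ofReal_le_ofReal ((modulusDensity_le_rpow h0.le hx).trans ?_)
        rw [mul_assoc]
        gcongr
        -- Here only `|log x| ≥ log 2 ≥ 1/2` is used.
        have := mul_half_rpow_le (l := 1) (c := coeff x) hx0 one_pos ?_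
        · simpa using this
        · rw [coeff, abs_of_neg hxlog]
          gcongr
          have h2 := Real.log_le_log hx0 hx.2
          rw [one_div, Real.log_inv] at h2
          linarith [Real.log_two_gt_d9]
      exact this.trans (le_add_left le_rfl)
  have hq : h ^ (1 / 4 : ℝ) ≤ 4 / l := by
    have := Real.abs_log_mul_self_rpow_lt h (1 / 4) h0 (by linarith) (by norm_num)
    rw [abs_mul, abs_of_pos (Real.rpow_pos_of_pos h0 _)] at this
    rw [le_div_iff₀ hl0]
    norm_num at this ⊢
    linarith
  calc ∫⁻ x in Ioc 0 (1 / 2), ENNReal.ofReal (modulusDensity h x)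
      ≤ ∫⁻ x in Ioc 0 (1 / 2), (F1 x + F2 x + F3 x + F4 x) :=
        setLIntegral_mono' measurableSet_Ioc hpt
    _ ≤ ∫⁻ x, (F1 x + F2 x + F3 x + F4 x) := setLIntegral_le_lintegral _ _
    _ = ENNReal.ofReal (8 * h ^ (1 / 4 : ℝ) * h) + ENNReal.ofReal (4 * h ^ (1 / 3 : ℝ) * δ)
        + ENNReal.ofReal (h ^ 2 * (6 * l ^ (-(5 / 2) : ℝ)) * (2 / 3 * δ ^ (-(3 / 2) : ℝ)))
        + ENNReal.ofReal (h ^ 2 * (6 * 1) * (2 / 3 * (h ^ (1 / 2 : ℝ)) ^ (-(3 / 2) : ℝ))) := by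
        rw [lintegral_add_left (by fun_prop), lintegral_add_left (by fun_prop),
          lintegral_add_left m1, lintegral_Ioc_const (by positivity),
          lintegral_Ioc_const (by positivity), lintegral_Ioi_rpow hδ0 (by positivity),
          lintegral_Ioi_rpow (by positivity) (by positivity)]
    _ = ENNReal.ofReal (8 * h ^ (1 / 4 : ℝ) * h + 4 * h ^ (1 / 3 : ℝ) * δ
        + h ^ 2 * (6 * l ^ (-(5 / 2) : ℝ)) * (2 / 3 * δ ^ (-(3 / 2) : ℝ))
        + h ^ 2 * (6 * 1) * (2 / 3 * (h ^ (1 / 2 : ℝ)) ^ (-(3 / 2) : ℝ))) := by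
        rw [ENNReal.ofReal_add (by positivity) (by positivity),
          ENNReal.ofReal_add (by positivity) (by positivity),
          ENNReal.ofReal_add (by positivity) (by positivity)]
    -- Since `h^(1/4) ≤ 4 / l`, the four terms contribute `32 + 4 + 4 + 16 = 56`.
    _ ≤ ENNReal.ofReal (56 * (h / l)) := by
        refine ENNReal.ofReal_le_ofReal ?_
        have e2 : h ^ (1 / 3 : ℝ) * δ = h / l := by
          rw [hδ, ← mul_div_assoc, ← Real.rpow_add h0]
          norm_num
        have e3 : h ^ 2 * l ^ (-(5 / 2) : ℝ) * δ ^ (-(3 / 2) : ℝ) = h / l := by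
          rw [hδ, Real.div_rpow (by positivity) hl0.le, ← Real.rpow_mul h0.le]
          rw [show h ^ 2 * l ^ (-(5 / 2) : ℝ) * (h ^ (2 / 3 * -(3 / 2) : ℝ) / l ^ (-(3 / 2) : ℝ))
            = (h ^ 2 * h ^ (2 / 3 * -(3 / 2) : ℝ)) * (l ^ (-(5 / 2) : ℝ) / l ^ (-(3 / 2) : ℝ)) by ring,
            ← Real.rpow_sub hl0, ← Real.rpow_natCast, ← Real.rpow_add h0]
          norm_num [Real.rpow_neg_one]
          rfl
        have e4 : h ^ 2 * (h ^ (1 / 2 : ℝ)) ^ (-(3 / 2) : ℝ) = h * h ^ (1 / 4 : ℝ) := by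
          rw [← Real.rpow_mul h0.le, ← Real.rpow_natCast, ← Real.rpow_add h0,
            ← Real.rpow_one_add' h0.le (by norm_num)]
          norm_num
        have e5 : h * h ^ (1 / 4 : ℝ) ≤ 4 * (h / l) := by
          calc h * h ^ (1 / 4 : ℝ) ≤ h * (4 / l) := by gcongr
            _ = 4 * (h / l) := by ring
        nlinarith [e2, e3, e4, e5]

theorem lintegral_modulusDensity_le_logModulus {h : ℝ} (h0 : 0 ≤ h) :
    ∫⁻ x in Ioc 0 (1 / 2), ENNReal.ofReal (modulusDensity h x)
      ≤ ENNReal.ofReal (56 * logModulus h ^ 2) := by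
  rcases h0.eq_or_lt with rfl | h0
  · simp [modulusDensity]
  rcases lt_or_ge h (1 / 4) with h1 | h1
  · refine (lintegral_modulusDensity_le h0 h1).trans_eq ?_
    rw [logModulus, if_pos h1, Real.sq_sqrt (by positivity)]
  · rw [logModulus, if_neg (not_lt.2 h1)]
    calc ∫⁻ x in Ioc 0 (1 / 2), ENNReal.ofReal (modulusDensity h x)
        ≤ ∫⁻ x in Ioc (0 : ℝ) (1 / 2), ENNReal.ofReal 4 := by
          refine setLIntegral_mono' measurableSet_Ioc fun x hx => ENNReal.ofReal_le_ofReal ?_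
          have := modulusDensity_le_sqrt h0.le hx
          have := Real.sqrt_le_one.2 (coeff_le_one hx)
          linarith
      _ = ENNReal.ofReal (4 * (1 / 2)) := by
          rw [setLIntegral_const, Real.volume_Ioc, sub_zero, ENNReal.ofReal_mul (by norm_num)]
      _ ≤ _ := ENNReal.ofReal_le_ofReal (by norm_num)

end Estimate

/-! ### Elements of the weighted space -/

section Weighted

theorem ae_baseMeasure_mem : ∀ᵐ x ∂baseMeasure, x ∈ Ioc (0 : ℝ) (1 / 2) := by
  have h0 : ∀ᵐ x ∂baseMeasure, x ≠ (0 : ℝ) := ae_restrict_of_ae (Measure.ae_ne volume 0)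
  have h1 : ∀ᵐ x ∂baseMeasure, x ∈ Icc (0 : ℝ) (1 / 2) := ae_restrict_mem measurableSet_Icc
  filter_upwards [h0, h1] with x hx0 hx1
  exact ⟨lt_of_le_of_ne hx1.1 (Ne.symm hx0), hx1.2⟩

theorem weightedMeasure_absolutelyContinuous : weightedMeasure ≪ baseMeasure :=
  withDensity_absolutelyContinuous _ _

theorem ae_weightedMeasure_iff {P : ℝ → Prop} :
    (∀ᵐ x ∂weightedMeasure, P x) ↔ ∀ᵐ x ∂baseMeasure, P x :=
  ⟨fun h => baseMeasure_le_weightedMeasure.absolutelyContinuous.ae_le h,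
    fun h => weightedMeasure_absolutelyContinuous.ae_le h⟩

theorem baseMeasure_eq : baseMeasure = volume.restrict (Ioc (0 : ℝ) (1 / 2)) :=
  (restrict_Ioc_eq_restrict_Icc).symm

theorem lintegral_weightedMeasure {f : ℝ → ℝ≥0∞} (hf : Measurable f) :
    ∫⁻ x, f x ∂weightedMeasure = ∫⁻ x in Ioc 0 (1 / 2), ENNReal.ofReal (weight x) * f x := by
  rw [weightedMeasure, lintegral_withDensity_eq_lintegral_mul _
    measurable_weight.ennreal_ofReal hf, baseMeasure_eq]
  rfl

/-- The function `c min(2, h w)`. -/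
def modulusFun (h x : ℝ) : ℝ := coeff x * min 2 (h * weight x)

theorem measurable_modulusFun (h : ℝ) : Measurable (modulusFun h) := by
  have := measurable_coeff
  have := measurable_weight
  unfold modulusFun
  fun_prop

theorem eLpNorm_modulusFun_le {h : ℝ} (h0 : 0 ≤ h) :
    eLpNorm (modulusFun h) 2 weightedMeasure ≤ ENNReal.ofReal (8 * logModulus h) := by
  have h1 : ∫⁻ x, ‖modulusFun h x‖ₑ ^ (2 : ℝ) ∂weightedMeasure
      = ∫⁻ x in Ioc 0 (1 / 2), ENNReal.ofReal (modulusDensity h x) := by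
    rw [lintegral_weightedMeasure (by have := measurable_modulusFun h; fun_prop)]
    refine setLIntegral_congr_fun measurableSet_Ioc fun x hx => ?_
    have hw := weight_pos hx
    rw [← ofReal_norm, ENNReal.ofReal_rpow_of_nonneg (norm_nonneg _) (by norm_num),
      ← ENNReal.ofReal_mul hw.le, modulusDensity, modulusFun, Real.rpow_two, Real.norm_eq_abs,
      sq_abs, mul_comm]
  rw [eLpNorm_eq_lintegral_rpow_enorm_toReal (by norm_num) (by norm_num)]
  rw [show (2 : ℝ≥0∞).toReal = 2 by simp, h1]
  refine (ENNReal.rpow_le_rpow (lintegral_modulusDensity_le_logModulus h0) (by norm_num)).trans ?_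
  have := logModulus_nonneg h
  rw [ENNReal.ofReal_rpow_of_nonneg (by positivity) (by norm_num), ← Real.sqrt_eq_rpow]
  -- The constant `8` comes from `56 ≤ 8²`.
  refine ENNReal.ofReal_le_ofReal (Real.sqrt_le_iff.2 ⟨by positivity, ?_⟩)
  nlinarith [sq_nonneg (logModulus h)]

theorem memLp_modulusFun {h : ℝ} (h0 : 0 ≤ h) : MemLp (modulusFun h) 2 weightedMeasure :=
  ⟨(measurable_modulusFun h).aestronglyMeasurable,
    (eLpNorm_modulusFun_le h0).trans_lt ENNReal.ofReal_lt_top⟩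

theorem norm_le_logModulus {f : SpaceV} {A h : ℝ} (hA : 0 ≤ A) (h0 : 0 ≤ h)
    (hf : ∀ᵐ x ∂baseMeasure, ‖f x‖ ≤ A * modulusFun h x) : ‖f‖ ≤ A * (8 * logModulus h) := by
  have hω := logModulus_nonneg h
  have h1 : ‖f‖ ≤ A * ‖(memLp_modulusFun h0).toLp‖ := by
    refine Lp.norm_le_mul_norm_of_ae_le_mul ?_
    filter_upwards [ae_weightedMeasure_iff.2 hf, (memLp_modulusFun h0).coeFn_toLp] with x hx hx2
    rw [hx2]
    exact hx.trans (mul_le_mul_of_nonneg_left (le_abs_self _) hA)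
  refine h1.trans (mul_le_mul_of_nonneg_left ?_ hA)
  rw [Lp.norm_toLp]
  exact ENNReal.toReal_le_of_le_ofReal (by positivity) (eLpNorm_modulusFun_le h0)

/-- As `w ≥ 1`, the function `c` is dominated by `modulusFun 1`, whose norm is already known to be
finite. -/
theorem memLp_coeff_mul {g : ℝ → ℝ} (hg : Measurable g) {A : ℝ} (hA : ∀ x, |g x| ≤ A) :
    MemLp (fun x => ((coeff x * g x : ℝ) : ℂ)) 2 weightedMeasure := by
  have hm := measurable_coeff
  refine (memLp_modulusFun (zero_le_one)).of_le_mul (c := A)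
    (Measurable.aestronglyMeasurable (by fun_prop)) ?_
  filter_upwards [ae_weightedMeasure_iff.2 ae_baseMeasure_mem] with x hx
  have hc := coeff_pos hx
  have hw := one_le_weight hx.1 hx.2
  have h1 : 1 ≤ min 2 (1 * weight x) := le_min (by norm_num) (by linarith)
  have hA0 : 0 ≤ A := (abs_nonneg _).trans (hA x)
  rw [Complex.norm_real, norm_mul, modulusFun, norm_mul, Real.norm_of_nonneg hc.le,
    Real.norm_eq_abs, Real.norm_of_nonneg (zero_le_one.trans h1)]
  calc coeff x * |g x| ≤ coeff x * A := by gcongr; exact hA x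
    _ ≤ coeff x * A * min 2 (1 * weight x) := le_mul_of_one_le_right (by positivity) h1
    _ = _ := by ring

/-- The class of `c g` in `V`, for a bounded measurable function `g`. -/
def coeffMul (g : ℝ → ℝ) (hg : Measurable g) {A : ℝ} (hA : ∀ x, |g x| ≤ A) : SpaceV :=
  (memLp_coeff_mul hg hA).toLp

theorem coeFn_coeffMul {g : ℝ → ℝ} (hg : Measurable g) {A : ℝ} (hA : ∀ x, |g x| ≤ A) :
    coeffMul g hg hA =ᵐ[weightedMeasure] fun x => ((coeff x * g x : ℝ) : ℂ) :=
  (memLp_coeff_mul hg hA).coeFn_toLp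

theorem inner_coeffMul_im {g k : ℝ → ℝ} (hg : Measurable g) {A : ℝ} (hA : ∀ x, |g x| ≤ A)
    (hk : Measurable k) {A' : ℝ} (hA' : ∀ x, |k x| ≤ A') :
    (inner ℂ (coeffMul g hg hA) (coeffMul k hk hA')).im = 0 := by
  have h : inner ℂ (coeffMul g hg hA) (coeffMul k hk hA')
      = ((∫ x, (coeff x * g x) * (coeff x * k x) ∂weightedMeasure : ℝ) : ℂ) := by
    rw [L2.inner_def]
    refine Eq.trans (integral_congr_ae ?_) integral_ofReal
    filter_upwards [coeFn_coeffMul hg hA, coeFn_coeffMul hk hA'] with x h1 h2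
    rw [h1, h2]
    simp [mul_comm]
  rw [h, Complex.ofReal_im]

/-! ### The embedding and its adjoint -/

theorem embed_injective : Function.Injective embed := by
  rw [injective_iff_map_eq_zero]
  intro f hf
  refine (Lp.eq_zero_iff_ae_eq_zero).2 (ae_weightedMeasure_iff.2 ?_)
  have h1 := coeFn_embed f
  rw [hf] at h1
  filter_upwards [h1, Lp.coeFn_zero ℂ 2 baseMeasure] with x h1 h2
  rw [← h1, h2]

theorem memLp_inv_weight_mul (h : SpaceH) :
    MemLp (fun x => ((weight x)⁻¹ : ℂ) * h x) 2 weightedMeasure := by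
  have hm := measurable_weight
  have hmeas : AEStronglyMeasurable (fun x => ((weight x)⁻¹ : ℂ) * h x) weightedMeasure :=
    AEStronglyMeasurable.mul (Measurable.aestronglyMeasurable (by fun_prop))
      ((Lp.aestronglyMeasurable h).mono_ac weightedMeasure_absolutelyContinuous)
  rw [memLp_two_iff_integrable_sq_norm hmeas, weightedMeasure,
    integrable_withDensity_iff_integrable_smul₀' (by fun_prop) (by simp)]
  have h1 := (memLp_two_iff_integrable_sq_norm (Lp.aestronglyMeasurable h)).1 (Lp.memLp h)
  refine h1.mono' ?_ ?_
  · have := (Lp.aestronglyMeasurable h)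
    refine AEStronglyMeasurable.smul (hm.ennreal_ofReal.ennreal_toReal.aestronglyMeasurable) ?_
    exact (AEStronglyMeasurable.mul (Measurable.aestronglyMeasurable (by fun_prop)) this).norm.pow 2
  · filter_upwards [ae_baseMeasure_mem] with x hx
    have hw := one_le_weight hx.1 hx.2
    have hw0 := weight_pos hx
    rw [ENNReal.toReal_ofReal hw0.le, norm_smul, Real.norm_of_nonneg hw0.le, norm_pow, norm_norm,
      norm_mul, norm_inv, Complex.norm_real, Real.norm_of_nonneg hw0.le]
    calc weight x * ((weight x)⁻¹ * ‖h x‖) ^ 2 = (weight x)⁻¹ * ‖h x‖ ^ 2 := by field_simp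
      _ ≤ 1 * ‖h x‖ ^ 2 := by gcongr; exact inv_le_one_of_one_le₀ hw
      _ = ‖h x‖ ^ 2 := one_mul _

/-- The adjoint is division by `w`, since this factor cancels against the density of the weighted
measure. -/
theorem coeFn_adjoint_embed (h : SpaceH) :
    embed.adjoint h =ᵐ[baseMeasure] fun x => ((weight x)⁻¹ : ℂ) * h x := by
  have hm := measurable_weight
  set v₀ : SpaceV := (memLp_inv_weight_mul h).toLp with hv₀
  have hv : v₀ =ᵐ[baseMeasure] fun x => ((weight x)⁻¹ : ℂ) * h x :=
    ae_weightedMeasure_iff.1 (memLp_inv_weight_mul h).coeFn_toLp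
  have key : embed.adjoint h = v₀ := by
    refine ext_inner_left ℂ fun v => ?_
    rw [ContinuousLinearMap.adjoint_inner_right, L2.inner_def, L2.inner_def]
    refine Eq.trans (integral_congr_ae ?_)
      (integral_withDensity_eq_integral_toReal_smul₀ (by fun_prop) (by simp) _).symm
    filter_upwards [ae_baseMeasure_mem, coeFn_embed v, hv] with x hx h1 h2
    have hw0 := weight_pos hx
    have hw1 : (weight x : ℂ) ≠ 0 := by exact_mod_cast hw0.ne'
    change inner ℂ (embed v x) (h x) = _ • inner ℂ (v x) (v₀ x)
    rw [h1, h2, ENNReal.toReal_ofReal hw0.le]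
    simp only [RCLike.inner_apply, Complex.real_smul]
    field_simp
  rw [key]
  exact hv

theorem denseRange_embed : DenseRange embed := by
  have h1 : (embed : SpaceV →ₗ[ℂ] SpaceH).rangeᗮ = ⊥ := by
    rw [embed.orthogonal_range, LinearMap.ker_eq_bot']
    intro h hh
    refine (Lp.eq_zero_iff_ae_eq_zero).2 ?_
    have h2 := coeFn_adjoint_embed h
    have hh' : embed.adjoint h = 0 := hh
    rw [hh'] at h2
    filter_upwards [h2, ae_weightedMeasure_iff.1 (Lp.coeFn_zero ℂ 2 weightedMeasure),
      ae_baseMeasure_mem] with x h2 h3 hx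
    rw [h3] at h2
    have hw1 : (weight x : ℂ) ≠ 0 := by exact_mod_cast (weight_pos hx).ne'
    simpa [hw1, eq_comm] using h2
  have h3 : ((embed : SpaceV →ₗ[ℂ] SpaceH).range).topologicalClosure = ⊤ := by
    rw [Submodule.topologicalClosure_eq_top_iff, h1]
  rw [DenseRange, dense_iff_closure_eq]
  exact congrArg (fun S : Submodule ℂ SpaceH => (S : Set SpaceH)) h3

end Weighted

/-! ### The oscillating curve -/

section Curve

theorem abs_sin_sub_sin_le_min (a b : ℝ) : |Real.sin a - Real.sin b| ≤ min 2 |a - b| := by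
  refine le_min ?_ (Real.abs_sin_sub_sin_le a b)
  rw [abs_le]
  constructor <;> linarith [Real.sin_le_one a, Real.sin_le_one b, Real.neg_one_le_sin a,
    Real.neg_one_le_sin b]

theorem abs_cos_sub_cos_le_min (a b : ℝ) : |Real.cos a - Real.cos b| ≤ min 2 |a - b| := by
  refine le_min ?_ (Real.abs_cos_sub_cos_le a b)
  rw [abs_le]
  constructor <;> linarith [Real.cos_le_one a, Real.cos_le_one b, Real.neg_one_le_cos a,
    Real.neg_one_le_cos b]

/-- Mean value inequality for `sin x - x cos a`, whose derivative `cos x - cos a` is at most `min(2,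
|b - a|)` between `a` and `b`. Keeping this minimum lets the Taylor remainder be measured by
`modulusFun`. -/
theorem abs_sin_sub_sin_sub_le (a b : ℝ) :
    |Real.sin b - Real.sin a - (b - a) * Real.cos a| ≤ |b - a| * min 2 |b - a| := by
  have h := Convex.norm_image_sub_le_of_norm_hasDerivWithin_le (s := uIcc a b)
    (f := fun x => Real.sin x - x * Real.cos a) (f' := fun x => Real.cos x - Real.cos a)
    (C := min 2 |b - a|) (x := a) (y := b)
    (fun x _ => ((Real.hasDerivAt_sin x).sub
      ((hasDerivAt_id x).mul_const (Real.cos a))).hasDerivWithinAt.congr_deriv (by simp))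
    (fun x hx => (abs_cos_sub_cos_le_min x a).trans
      (min_le_min_left 2 (abs_sub_left_of_mem_uIcc hx)))
    (convex_uIcc a b) left_mem_uIcc right_mem_uIcc
  rw [Real.norm_eq_abs, Real.norm_eq_abs, mul_comm (min 2 _)] at h
  refine le_of_eq_of_le ?_ h
  congr 1
  ring

theorem hasDerivAt_of_norm_sub_le_logModulus {V : Type*} [NormedAddCommGroup V]
    [InnerProductSpace ℂ V] {f : ℝ → V} {f' : V} {t : ℝ}
    (hle : ∀ τ, ‖f τ - f t - ((τ - t : ℝ) : ℂ) • f'‖ ≤ |τ - t| * (8 * logModulus |τ - t|)) :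
    HasDerivAt f f' t := by
  rw [hasDerivAt_iff_isLittleO, Asymptotics.isLittleO_iff]
  intro ε hε
  have h1 : Tendsto (fun τ => |τ - t|) (𝓝 t) (𝓝[≥] 0) := by
    refine tendsto_nhdsWithin_iff.2 ⟨?_, Eventually.of_forall fun s => mem_Ici.2 (abs_nonneg _)⟩
    have : Continuous fun τ => |τ - t| := by fun_prop
    simpa using this.tendsto t
  have h2 : Tendsto (fun τ => 8 * logModulus |τ - t|) (𝓝 t) (𝓝 0) := by
    simpa using (tendsto_logModulus.comp h1).const_mul 8
  filter_upwards [h2.eventually_lt_const hε] with τ hτ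
  rw [← Complex.coe_smul]
  refine (hle τ).trans ?_
  rw [mul_comm, Real.norm_eq_abs]
  gcongr

/-- The curve `u(t) = c (sin (t w) + d)` in `V`. -/
def curve (d t : ℝ) : SpaceV :=
  coeffMul (fun x => Real.sin (t * weight x) + d)
    (by have := measurable_weight; fun_prop) (A := 1 + |d|)
    (fun x => (abs_add_le _ _).trans (by gcongr; exact Real.abs_sin_le_one _))

/-- The curve `c cos (t w)` in `V`, which represents the derivative of `curve d` in `V'`. -/
def curveDeriv (t : ℝ) : SpaceV :=
  coeffMul (fun x => Real.cos (t * weight x))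
    (by have := measurable_weight; fun_prop) (A := 1) (fun x => Real.abs_cos_le_one _)

/-- The function `c` as an element of `V`. -/
def coeffV : SpaceV := coeffMul (fun _ => 1) measurable_const (A := 1) (fun _ => by simp)

theorem coeFn_curve (d t : ℝ) :
    curve d t =ᵐ[weightedMeasure] fun x => ((profile d t x : ℝ) : ℂ) := coeFn_coeffMul _ _

theorem coeFn_curve_base (d t : ℝ) : curve d t =ᵐ[baseMeasure]
    fun x => ((coeff x * (Real.sin (t * weight x) + d) : ℝ) : ℂ) :=
  ae_weightedMeasure_iff.1 (coeFn_coeffMul _ _)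

theorem coeFn_curveDeriv (t : ℝ) : curveDeriv t =ᵐ[baseMeasure]
    fun x => ((coeff x * Real.cos (t * weight x) : ℝ) : ℂ) :=
  ae_weightedMeasure_iff.1 (coeFn_coeffMul _ _)

theorem coeFn_coeffV : coeffV =ᵐ[baseMeasure] fun x => (coeff x : ℂ) := by
  have : coeffV =ᵐ[baseMeasure] fun x => ((coeff x * 1 : ℝ) : ℂ) :=
    ae_weightedMeasure_iff.1 (coeFn_coeffMul _ _)
  simpa using this

theorem mul_min_abs_eq {x : ℝ} (hx : x ∈ Ioc (0 : ℝ) (1 / 2)) (t s : ℝ) :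
    coeff x * min 2 |t * weight x - s * weight x| = modulusFun |t - s| x := by
  rw [← sub_mul, abs_mul, abs_of_pos (weight_pos hx), modulusFun]

theorem hasLogModulus_curve (d : ℝ) : HasLogModulus (curve d) := by
  refine ⟨8, by norm_num, fun t s => ?_⟩
  rw [← one_mul (8 * _)]
  refine norm_le_logModulus zero_le_one (abs_nonneg (t - s)) ?_
  filter_upwards [ae_baseMeasure_mem, coeFn_curve_base d t, coeFn_curve_base d s,
    ae_weightedMeasure_iff.1 (Lp.coeFn_sub (curve d t) (curve d s))] with x hx h1 h2 h3
  rw [h3, Pi.sub_apply, h1, h2, one_mul, ← mul_min_abs_eq hx, ← Complex.ofReal_sub,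
    Complex.norm_real, ← mul_sub, norm_mul, Real.norm_of_nonneg (coeff_pos hx).le,
    add_sub_add_right_eq_sub]
  exact mul_le_mul_of_nonneg_left (abs_sin_sub_sin_le_min _ _) (coeff_pos hx).le

theorem hasLogModulus_curveDeriv : HasLogModulus curveDeriv := by
  refine ⟨8, by norm_num, fun t s => ?_⟩
  rw [← one_mul (8 * _)]
  refine norm_le_logModulus zero_le_one (abs_nonneg (t - s)) ?_
  filter_upwards [ae_baseMeasure_mem, coeFn_curveDeriv t, coeFn_curveDeriv s,
    ae_weightedMeasure_iff.1 (Lp.coeFn_sub (curveDeriv t) (curveDeriv s))] with x hx h1 h2 h3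
  rw [h3, Pi.sub_apply, h1, h2, one_mul, ← mul_min_abs_eq hx, ← Complex.ofReal_sub,
    Complex.norm_real, ← mul_sub, norm_mul, Real.norm_of_nonneg (coeff_pos hx).le]
  exact mul_le_mul_of_nonneg_left (abs_cos_sub_cos_le_min _ _) (coeff_pos hx).le

theorem coeFn_gramOp_embed (v : SpaceV) :
    gramOp embed v =ᵐ[baseMeasure] fun x => ((weight x)⁻¹ : ℂ) * v x := by
  filter_upwards [coeFn_adjoint_embed (embed v), coeFn_embed v] with x h1 h2
  rw [← h2, ← h1]
  rfl

/-- The factor `1/w` of the Gram operator cancels the `w` in `|τ w - t w|`, so the remainder is `|τ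
- t|` times `modulusFun |τ - t|`. -/
theorem norm_gramOp_curve_sub_le (d t τ : ℝ) :
    ‖gramOp embed (curve d τ) - gramOp embed (curve d t) - ((τ - t : ℝ) : ℂ) • curveDeriv t‖
      ≤ |τ - t| * (8 * logModulus |τ - t|) := by
  refine norm_le_logModulus (abs_nonneg _) (abs_nonneg _) ?_
  filter_upwards [ae_baseMeasure_mem, coeFn_curve_base d t, coeFn_curve_base d τ,
    coeFn_curveDeriv t, coeFn_gramOp_embed (curve d τ), coeFn_gramOp_embed (curve d t),
    ae_weightedMeasure_iff.1 (Lp.coeFn_sub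
      (gramOp embed (curve d τ) - gramOp embed (curve d t)) (((τ - t : ℝ) : ℂ) • curveDeriv t)),
    ae_weightedMeasure_iff.1 (Lp.coeFn_sub
      (gramOp embed (curve d τ)) (gramOp embed (curve d t))),
    ae_weightedMeasure_iff.1 (Lp.coeFn_smul ((τ - t : ℝ) : ℂ) (curveDeriv t))]
    with x hx h1 h2 h3 h4 h5 h6 h7 h8
  have hw := weight_pos hx
  have hc := coeff_pos hx
  rw [h6, Pi.sub_apply, h7, Pi.sub_apply, h8, Pi.smul_apply, h4, h5, h1, h2, h3, smul_eq_mul]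
  have e : ((weight x)⁻¹ : ℂ) * ((coeff x * (Real.sin (τ * weight x) + d) : ℝ) : ℂ)
      - ((weight x)⁻¹ : ℂ) * ((coeff x * (Real.sin (t * weight x) + d) : ℝ) : ℂ)
      - ((τ - t : ℝ) : ℂ) * ((coeff x * Real.cos (t * weight x) : ℝ) : ℂ)
      = (((weight x)⁻¹ * coeff x * (Real.sin (τ * weight x) - Real.sin (t * weight x)
        - (τ * weight x - t * weight x) * Real.cos (t * weight x)) : ℝ) : ℂ) := by
    have hw1 : (weight x : ℂ) ≠ 0 := by exact_mod_cast hw.ne'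
    push_cast
    field_simp
    ring
  rw [e, Complex.norm_real, norm_mul, Real.norm_of_nonneg (by positivity), Real.norm_eq_abs]
  have h9 := abs_sin_sub_sin_sub_le (t * weight x) (τ * weight x)
  calc _ ≤ (weight x)⁻¹ * coeff x * (|τ * weight x - t * weight x|
        * min 2 |τ * weight x - t * weight x|) := by gcongr
    _ = ((weight x)⁻¹ * |τ * weight x - t * weight x|)
        * (coeff x * min 2 |τ * weight x - t * weight x|) := by ring
    _ = |τ - t| * modulusFun |τ - t| x := by
        rw [mul_min_abs_eq hx, ← sub_mul, abs_mul, abs_of_pos hw]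
        field_simp

/-- A preimage under division by `w` would be `c w cos(tw)`, the pointwise time derivative, which is
not square integrable. -/
theorem curveDeriv_notMem_range {t : ℝ} (ht : 0 ≤ t) : curveDeriv t ∉ range embed.adjoint := by
  rintro ⟨h, hh⟩
  refine not_memLp_deriv ht ((memLp_congr_ae ?_).1 (Lp.memLp h))
  have h1 := coeFn_adjoint_embed h
  rw [hh] at h1
  filter_upwards [h1, coeFn_curveDeriv t, ae_baseMeasure_mem] with x h1 h2 hx
  have hw1 : (weight x : ℂ) ≠ 0 := by exact_mod_cast (weight_pos hx).ne'
  rw [h2, eq_inv_mul_iff_mul_eq₀ hw1] at h1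
  rw [← h1, ← coeff]
  push_cast
  ring

theorem norm_curve_le {d : ℝ} (hd : 0 ≤ d) (t : ℝ) : ‖curve d t‖ ≤ (d + 1) * ‖coeffV‖ := by
  refine Lp.norm_le_mul_norm_of_ae_le_mul (ae_weightedMeasure_iff.2 ?_)
  filter_upwards [ae_baseMeasure_mem, coeFn_curve_base d t, coeFn_coeffV] with x hx h1 h2
  have hc := coeff_pos hx
  rw [h1, h2, Complex.norm_real, Complex.norm_real, norm_mul, Real.norm_of_nonneg hc.le, mul_comm]
  gcongr
  rw [Real.norm_eq_abs, abs_le]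
  constructor <;> linarith [Real.sin_le_one (t * weight x), Real.neg_one_le_sin (t * weight x)]

theorem norm_curveDeriv_le (t : ℝ) : ‖curveDeriv t‖ ≤ ‖coeffV‖ := by
  refine Lp.norm_le_norm_of_ae_le (ae_weightedMeasure_iff.2 ?_)
  filter_upwards [ae_baseMeasure_mem, coeFn_curveDeriv t, coeFn_coeffV] with x hx h1 h2
  have hc := coeff_pos hx
  rw [h1, h2, Complex.norm_real, Complex.norm_real, norm_mul, Real.norm_of_nonneg hc.le]
  exact mul_le_of_le_one_right hc.le (Real.abs_cos_le_one _)

theorem le_norm_embed_curve {d : ℝ} (hd : 1 < d) (t : ℝ) :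
    (d - 1) * ‖embed coeffV‖ ≤ ‖embed (curve d t)‖ := by
  have hd' : 0 < d - 1 := by linarith
  have h : ‖embed coeffV‖ ≤ (d - 1)⁻¹ * ‖embed (curve d t)‖ := by
    refine Lp.norm_le_mul_norm_of_ae_le_mul ?_
    filter_upwards [ae_baseMeasure_mem, coeFn_curve_base d t, coeFn_coeffV, coeFn_embed coeffV,
      coeFn_embed (curve d t)] with x hx h1 h2 h3 h4
    have hc := coeff_pos hx
    have hs : d - 1 ≤ Real.sin (t * weight x) + d := by linarith [Real.neg_one_le_sin (t * weight x)]
    rw [h3, h4, h1, h2, Complex.norm_real, Complex.norm_real, norm_mul, Real.norm_of_nonneg hc.le,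
      Real.norm_of_nonneg (hd'.le.trans hs), le_inv_mul_iff₀ hd', mul_comm]
    gcongr
  rwa [le_inv_mul_iff₀ hd'] at h

theorem norm_embed_coeffV_pos : 0 < ‖embed coeffV‖ := by
  rw [norm_pos_iff, ne_eq, map_eq_zero_iff _ embed_injective]
  intro h0
  have h1 := coeFn_coeffV
  rw [h0] at h1
  have h2 : ∀ᵐ x ∂baseMeasure, False := by
    filter_upwards [h1, ae_weightedMeasure_iff.1 (Lp.coeFn_zero ℂ 2 weightedMeasure),
      ae_baseMeasure_mem] with x h1 h2 hx
    rw [h2, Pi.zero_apply] at h1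
    exact (coeff_pos hx).ne' (by exact_mod_cast h1.symm)
  have h3 : baseMeasure ≠ 0 := by
    intro h
    have := congrArg (fun μ : Measure ℝ => μ univ) h
    simp [baseMeasure] at this
  exact h3 (ae_eq_bot.1 (eventually_false_iff_eq_bot.1 h2))

end Curve

/-! ### Pointwise time derivative and choice of the constant `d` -/

theorem hasDerivAt_profile (d t x : ℝ) : HasDerivAt (fun τ => profile d τ x)
    (x * |Real.log x| * (Real.cos (t * weight x) * weight x)) t := by
  have h1 : HasDerivAt (fun τ => τ * weight x) (weight x) t := by
    simpa using (hasDerivAt_id t).mul_const (weight x)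
  exact (h1.sin.add_const d).const_mul _

/-- For large `d`, the form constructed along `curve d` is coercive. -/
theorem exists_curve_coercive : ∃ d₀ : ℝ, 0 < d₀ ∧ ∀ d, d₀ ≤ d → 0 ≤ d ∧
    ∀ t, 1 ≤ ‖embed (curve d t)‖ ^ 2 - (inner ℂ (curveDeriv t) (curve d t)).re := by
  set A := ‖embed coeffV‖ with hA
  set C := ‖coeffV‖ with hC
  have hA0 : 0 < A := norm_embed_coeffV_pos
  have hC0 : 0 ≤ C := norm_nonneg _
  -- Ensures `(d - 1) A² ≥ 3 C² + 1`. Then `(d - 1)² A² ≥ (d - 1)(3 C² + 1)`, which exceeds `(d + 1)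
  -- C²` by at least `1` once `d ≥ 2`.
  refine ⟨2 + (3 * C ^ 2 + 1) / A ^ 2, by positivity, fun d hd => ?_⟩
  have hq : 0 ≤ (3 * C ^ 2 + 1) / A ^ 2 := by positivity
  refine ⟨by linarith, fun t => ?_⟩
  have h1 : (3 * C ^ 2 + 1) ≤ (d - 1) * A ^ 2 := by
    rw [← div_le_iff₀ (by positivity)]
    linarith
  have h2 : ((d - 1) * A) ^ 2 ≤ ‖embed (curve d t)‖ ^ 2 := by
    have : 0 ≤ d - 1 := by linarith
    gcongr
    exact le_norm_embed_curve (by linarith) t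
  have h3 : (inner ℂ (curveDeriv t) (curve d t)).re ≤ C * ((d + 1) * C) := by
    refine (RCLike.re_le_norm (K := ℂ) _).trans ((norm_inner_le_norm _ _).trans ?_)
    gcongr
    · exact norm_curveDeriv_le t
    · exact norm_curve_le (by linarith) t
  have h4 : (d - 1) * (3 * C ^ 2 + 1) ≤ (d - 1) * ((d - 1) * A ^ 2) :=
    mul_le_mul_of_nonneg_left h1 (by linarith)
  nlinarith [mul_nonneg (show 0 ≤ d - 2 by linarith) (sq_nonneg C)]

end NonAutonomousForms

end

/-! ### The main theorem -/

theorem mainTheorem7 :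
    -- V is densely embedded into H
    Function.Injective NonAutonomousForms.embed ∧ DenseRange NonAutonomousForms.embed ∧
    ∃ d₀ : ℝ, 0 < d₀ ∧ ∀ d : ℝ, d₀ ≤ d → ∀ T : ℝ, 0 < T →
      -- the time derivative of u(t,x) at time t is, as a function of x, not in H
      (∀ t ∈ Set.Icc (0 : ℝ) T,
        (∀ x : ℝ, DifferentiableAt ℝ (fun τ => NonAutonomousForms.profile d τ x) t) ∧
        ¬ MeasureTheory.MemLp
          (fun x => ((deriv (fun τ => NonAutonomousForms.profile d τ x) t : ℝ) : ℂ)) 2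
          NonAutonomousForms.baseMeasure) ∧
      ∃ u : ℝ → NonAutonomousForms.SpaceV,
        -- u as a V-valued function
        (∀ t ∈ Set.Icc (0 : ℝ) T, u t =ᵐ[NonAutonomousForms.weightedMeasure]
          fun x => ((NonAutonomousForms.profile d t x : ℝ) : ℂ)) ∧
        MeasureTheory.MemLp u ⊤ (MeasureTheory.volume.restrict (Set.Icc (0 : ℝ) T)) ∧
        -- fractional regularity of u
        (∀ q : ℝ, 2 < q → NonAutonomousForms.MemFracSobolev T (1 / 2) q u) ∧
        ∃ u' : ℝ → NonAutonomousForms.AntiDual NonAutonomousForms.SpaceV,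
          -- u is continuously differentiable in V', and its derivative is never in H
          ContinuousOn u' (Set.Icc 0 T) ∧
          (∀ t ∈ Set.Icc (0 : ℝ) T,
            HasDerivWithinAt
              (fun τ => NonAutonomousForms.toAntiDual NonAutonomousForms.embed
                (NonAutonomousForms.embed (u τ)))
              (u' t) (Set.Icc 0 T) t ∧
            u' t ∉ Set.range (NonAutonomousForms.toAntiDual NonAutonomousForms.embed)) ∧
          -- the symmetric form problem
          ∃ a : ℝ → NonAutonomousForms.SesqForm NonAutonomousForms.SpaceV,
            NonAutonomousForms.IsBoundedCoercive T a ∧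
            NonAutonomousForms.IsSymmetricForm T a ∧
            (∀ q : ℝ, 2 < q → NonAutonomousForms.MemFracSobolev T (1 / 2) q a) ∧
            -- u solves the problem for the right-hand side f = u
            (∀ t ∈ Set.Icc (0 : ℝ) T,
              u' t + a t (u t) = NonAutonomousForms.toAntiDual NonAutonomousForms.embed
                (NonAutonomousForms.embed (u t))) ∧
            NonAutonomousForms.IsIntegratedSolution NonAutonomousForms.embed T a
              (fun t => NonAutonomousForms.embed (u t)) (NonAutonomousForms.embed (u 0)) u ∧
            -- maximal regularity fails for every p
            (∀ p : ENNReal, 1 ≤ p →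
              ¬ NonAutonomousForms.HasMaximalRegularity NonAutonomousForms.embed T p a) ∧
            -- it fails already for zero initial value and one f in L^∞([0,T];V)
            ∃ f : ℝ → NonAutonomousForms.SpaceV,
              MeasureTheory.MemLp f ⊤
                (MeasureTheory.volume.restrict (Set.Icc (0 : ℝ) T)) ∧
              ∀ p : ENNReal, 1 ≤ p → ¬ ∃ v v' g : ℝ → NonAutonomousForms.SpaceH,
                NonAutonomousForms.IsMaxRegSolution NonAutonomousForms.embed T p a
                  (fun t => NonAutonomousForms.embed (f t)) 0 v v' g := by
  refine ⟨NonAutonomousForms.embed_injective, NonAutonomousForms.denseRange_embed, ?_⟩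
  obtain ⟨d₀, h₀, hd₀⟩ := NonAutonomousForms.exists_curve_coercive
  refine ⟨d₀, h₀, fun d hd T hT => ⟨fun t ht => ?_, NonAutonomousForms.curve d,
    fun t _ => NonAutonomousForms.coeFn_curve d t, ?_,
    fun q hq => (NonAutonomousForms.hasLogModulus_curve d).memFracSobolev T hq, ?_⟩⟩
  · have hder := NonAutonomousForms.hasDerivAt_profile d t
    refine ⟨fun x => (hder x).differentiableAt, ?_⟩
    simp only [(hder _).deriv]
    exact NonAutonomousForms.not_memLp_deriv ht.1
  · exact MeasureTheory.memLp_top_of_bound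
      (NonAutonomousForms.hasLogModulus_curve d).continuous.aestronglyMeasurable _
      (Filter.Eventually.of_forall (NonAutonomousForms.norm_curve_le (hd₀ d hd).1))
  · have hd0 := (hd₀ d hd).1
    have hC : 0 ≤ ‖NonAutonomousForms.coeffV‖ := norm_nonneg _
    have hu := NonAutonomousForms.norm_curve_le hd0
    refine NonAutonomousForms.exists_form_of_curve
      (C := (d + 1) * ‖NonAutonomousForms.coeffV‖) NonAutonomousForms.embed_injective
      (NonAutonomousForms.hasLogModulus_curve d) NonAutonomousForms.hasLogModulus_curveDeriv hu
      (fun t => (NonAutonomousForms.norm_curveDeriv_le t).trans (by nlinarith))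
      (fun t => NonAutonomousForms.hasDerivAt_of_norm_sub_le_logModulus
        (NonAutonomousForms.norm_gramOp_curve_sub_le d t))
      (fun t ht => NonAutonomousForms.curveDeriv_notMem_range ht)
      (fun t => NonAutonomousForms.inner_coeffMul_im _ _ _ _) one_pos (hd₀ d hd).2 hT
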